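/- **Flexible bandwidth allocation.** An instance consists of an integer $W>0$ (the amount of the resource; the units are called colors $1,\dots,W$) and jobs $J_1,\dots,J_n$, where $J_i$ has a half-open interval $[s_i,e_i)$ with real endpoints $0\le s_i<e_i$, integer bounds $r_{\min}(i),r_{\max}(i)\ge 0$, and a profit $p_i\ge 1$ per unit. A feasible solution gives each $J_i$ an integer amount $x_i$ with $r_{\min}(i)\le x_i\le r_{\max}(i)$ such that $\sum_{i:\,t\in[s_i,e_i)}x_i\le W$ at every time $t$; it is optimal if it maximizes $\sum_i p_ix_i$. Color sets $A_1,\dots,A_n\subseteq\{1,\dots,W\}$ form a (not necessarily contiguous) coloring if $A_i\cap A_j=\emptyset$ whenever $i\neq j$ and $[s_i,e_i)\cap[s_j,e_j)\ne\emptyset$. **Algorithm Paging_FBA.** Coinciding endpoints are first made distinct by ordering them arbitrarily, except that right endpoints come before left ones. Initially $\mathrm{AVAIL}=\{1,\dots,W\}$ and all $A_i=\emptyset$. The endpoints are scanned from left to right. When a left endpoint $s_i$ is scanned: 1. $\min(|\mathrm{AVAIL}|,r_{\min}(i))$ colors are moved from $\mathrm{AVAIL}$ to $A_i$; 2. while $|A_i|<r_{\min}(i)$,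 let $J_k$ be the job with $s_k<s_i<e_k$ and $|A_k|>r_{\min}(k)$ whose right endpoint is largest, and move $\min(|A_k|-r_{\min}(k),\,r_{\min}(i)-|A_i|)$ colors from $A_k$ to $A_i$; 3. $\min(|\mathrm{AVAIL}|,r_{\max}(i)-r_{\min}(i))$ colors are moved from $\mathrm{AVAIL}$ to $A_i$; 4. while $|A_i|<r_{\max}(i)$ and there is a job $J_k$ with $s_k<s_i$, $e_k>e_i$ and $|A_k|>r_{\min}(k)$, take the one whose right endpoint is largest and move $\min(|A_k|-r_{\min}(k),\,r_{\max}(i)-|A_i|)$ colors from $A_k$ to $A_i$. When a right endpoint $e_i$ is scanned, $\mathrm{AVAIL}$ is replaced by $\mathrm{AVAIL}\cup A_i$. Which colors are moved is left to an arbitrary rule that picks a subset of the prescribed size of a given set. At the end the sets $A_1,\dots,A_n$ are returned. **Theorem.** Consider instances that have a feasible solution and satisfy $p_i=1$ for all $i$. (a) On every such instance, whatever the order of coinciding endpoints and whatever the rule for picking colors, the sets $A_1,\dots,A_n$ returned by Paging_FBA form a coloring, and $x_i=|A_i|$ is an optimal feasible solution. (b) Paging_FBA can be implemented in $O(n\log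 n)$ time: there are a program for a unit-cost random access machine (addition, truncated subtraction, halving, comparison and indirect addressing on natural numbers; the real endpoints can only be compared) and a constant $C$ such that on every such instance the program halts after at most $C(n\lfloor\log_2 n\rfloor+1)$ steps and outputs, for some admissible order of coinciding endpoints, the numbers $|A_1|,\dots,|A_n|$, the total profit $\sum_i|A_i|$, and a list of operations of the forms "move $m$ colors from $\mathrm{AVAIL}$ to $A_i$", "move $m$ colors from $A_k$ to $A_i$" and "replace $\mathrm{AVAIL}$ by $\mathrm{AVAIL}\cup A_i$" which, executed from the initial state, produces exactly the sets $A_1,\dots,A_n$ returned by Paging_FBA, for every rule for picking colors. -/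

import Mathlib

/-! ### The flexible bandwidth allocation problem -/

/-- An instance with `n` jobs: `W` units of the resource (colors `1, …, W`); job `i` occupies the
half-open interval `[s i, e i)`, must get between `rmin i` and `rmax i` units, and yields profit
`p i` per unit. -/
structure FBAP (n : ℕ) where
  W : ℕ
  s : Fin n → ℝ
  e : Fin n → ℝ
  rmin : Fin n → ℕ
  rmax : Fin n → ℕ
  p : Fin n → ℝ
  W_pos : 0 < W
  s_nonneg : ∀ i, 0 ≤ s i
  s_lt_e : ∀ i, s i < e i
  one_le_p : ∀ i, 1 ≤ p i

namespace FBAP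

variable {n : ℕ}

/-- `x i` units for job `i` is a feasible solution: all amounts are in their ranges and at no time
more than `W` units are in use. -/
def IsAllocation (I : FBAP n) (x : Fin n → ℕ) : Prop :=
  (∀ i, I.rmin i ≤ x i ∧ x i ≤ I.rmax i) ∧
    ∀ t : ℝ, ∑ i, (Set.Ico (I.s i) (I.e i)).indicator (fun _ => x i) t ≤ I.W

/-- The instance is feasible. -/
def Feasible (I : FBAP n) : Prop := ∃ x, I.IsAllocation x

/-- The total profit. -/
noncomputable def profit (I : FBAP n) (x : Fin n → ℕ) : ℝ := ∑ i, I.p i * (x i : ℝ)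

/-- A feasible solution of maximum profit. -/
def IsOptimal (I : FBAP n) (x : Fin n → ℕ) : Prop :=
  I.IsAllocation x ∧ ∀ y, I.IsAllocation y → I.profit y ≤ I.profit x

/-- Jobs get sets of colors from `{1, …, W}`, and jobs that intersect get disjoint sets. -/
def IsColoring (I : FBAP n) (A : Fin n → Finset ℕ) : Prop :=
  (∀ i, A i ⊆ Finset.Icc 1 I.W) ∧
    ∀ i j, i ≠ j → ¬ Disjoint (Set.Ico (I.s i) (I.e i)) (Set.Ico (I.s j) (I.e j)) →
      Disjoint (A i) (A j)

end FBAP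

/-! ### The algorithm Paging_FBA -/

/-- The endpoints of the jobs. -/
inductive Endpoint (n : ℕ) where
  | left (i : Fin n)
  | right (i : Fin n)
  deriving DecidableEq

namespace Endpoint

variable {n : ℕ}

/-- The position of an endpoint on the real line. -/
def pos (I : FBAP n) : Endpoint n → ℝ
  | left i => I.s i
  | right i => I.e i

/-- `a` may be scanned before `b`: it lies further to the left, or they coincide and it is not the
case that `a` is a left and `b` a right endpoint (intervals are half-open). -/
def MayPrecede (I : FBAP n) (a b : Endpoint n) : Prop :=
  a.pos I < b.pos I ∨ (a.pos I = b.pos I ∧ ∀ i j, ¬ (a = left i ∧ b = right j))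

/-- The job of a right endpoint. -/
def rightJob : Endpoint n → Option (Fin n)
  | left _ => none
  | right i => some i

end Endpoint

/-- The list of all endpoints from left to right, coinciding endpoints being made distinct by an
arbitrary choice that puts right endpoints before left ones. -/
def FBAP.IsScanOrder {n : ℕ} (I : FBAP n) (L : List (Endpoint n)) : Prop :=
  L.Nodup ∧ (∀ a, a ∈ L) ∧ L.Pairwise (Endpoint.MayPrecede I)

/-- The state of the algorithm: the available colors and the color sets of the jobs. -/
@[ext] structure FBAState (n : ℕ) where
  avail : Finset ℕ
  A : Fin n → Finset ℕ

/-- The elementary operations on the color sets. -/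
inductive ColorOp (n : ℕ) where
  /-- move `m` colors from `AVAIL` to `A i` -/
  | take (i : Fin n) (m : ℕ)
  /-- move `m` colors from `A k` to `A i` -/
  | move (k i : Fin n) (m : ℕ)
  /-- `AVAIL := AVAIL ∪ A i` -/
  | release (i : Fin n)

/-- A rule that says which `m` colors of a set are moved when `m` colors are to be moved. -/
def IsPick (pick : Finset ℕ → ℕ → Finset ℕ) : Prop :=
  ∀ S m, m ≤ S.card → pick S m ⊆ S ∧ (pick S m).card = m

namespace FBAState

variable {n : ℕ}

/-- The effect of an elementary operation. -/
def apply (pick : Finset ℕ → ℕ → Finset ℕ) (σ : FBAState n) : ColorOp n → FBAState n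
  | .take i m =>
      { avail := σ.avail \ pick σ.avail m
        A := Function.update σ.A i (σ.A i ∪ pick σ.avail m) }
  | .move k i m =>
      { avail := σ.avail
        A := Function.update (Function.update σ.A k (σ.A k \ pick (σ.A k) m)) i
          (σ.A i ∪ pick (σ.A k) m) }
  | .release i =>
      { avail := σ.avail ∪ σ.A i
        A := σ.A }

end FBAState

namespace FBAP

variable {n : ℕ}

/-- Initially all colors are available. -/
def initState (I : FBAP n) : FBAState n where
  avail := Finset.Icc 1 I.W
  A := fun _ => ∅

/-- The jobs `k` with `s k < s i` and `e k > a`, from the furthest right endpoint to the nearest,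
where endpoints are compared in the scan order `L`. -/
def candidates (L : List (Endpoint n)) (i : Fin n) (a : Endpoint n) : List (Fin n) :=
  (L.reverse.filterMap Endpoint.rightJob).filter fun k =>
    decide (L.idxOf (.left k) < L.idxOf (.left i) ∧ L.idxOf a < L.idxOf (.right k))

/-- The loop `while |A i| < r`: for the `k` in the list `ks` with `|A k| > rmin k` whose right
endpoint is furthest, move `min (|A k| - rmin k) (r - |A i|)` colors from `A k` to `A i`. After
such a move `k` is no candidate any more or the loop ends, so it is one pass over `ks` (for which
the list is in decreasing order of right endpoints). -/
def reassign (I : FBAP n) (pick : Finset ℕ → ℕ → Finset ℕ) (i : Fin n) (r : ℕ)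
    (ks : List (Fin n)) (σ : FBAState n) : FBAState n :=
  ks.foldl
    (fun σ k => σ.apply pick
      (.move k i (min ((σ.A k).card - I.rmin k) (r - (σ.A i).card)))) σ

/-- What the algorithm does when it scans an endpoint. -/
def scan (I : FBAP n) (pick : Finset ℕ → ℕ → Finset ℕ) (L : List (Endpoint n))
    (σ : FBAState n) : Endpoint n → FBAState n
  | .left i =>
      -- feasibility: `rmin i` colors, available ones first, then those of the jobs that are
      -- active at `s i`
      let σ₁ := σ.apply pick (.take i (min σ.avail.card (I.rmin i)))
      let σ₂ := I.reassign pick i (I.rmin i) (candidates L i (.left i)) σ₁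
      -- profit: up to `rmax i - rmin i` more colors, available ones first, then those of the
      -- active jobs that end after `e i`
      let σ₃ := σ₂.apply pick (.take i (min σ₂.avail.card (I.rmax i - I.rmin i)))
      I.reassign pick i (I.rmax i) (candidates L i (.right i)) σ₃
  | .right i => σ.apply pick (.release i)

/-- The color sets that Paging_FBA returns. -/
def pagingFBA (I : FBAP n) (pick : Finset ℕ → ℕ → Finset ℕ) (L : List (Endpoint n)) :
    Fin n → Finset ℕ :=
  (L.foldl (I.scan pick L) I.initState).A

end FBAP

/-! ### Random access machines with unit costs

The memory consists of registers and arrays of natural numbers, each program using finitely many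
of them. In addition there is a read-only array `key` of real numbers, which can only be compared
with each other. -/

namespace RAM

/-- The memory: `reg x` is register `x`, and `arr a i` is cell `i` of array `a`. -/
structure Mem where
  reg : ℕ → ℕ
  arr : ℕ → ℕ → ℕ

/-- Arithmetic expressions. -/
inductive Exp where
  | lit (c : ℕ)
  | reg (x : ℕ)
  | get (a : ℕ) (i : Exp)
  | add (u v : Exp)
  | sub (u v : Exp)
  | half (u : Exp)

namespace Exp

/-- The value; subtraction is truncated and `half` rounds down. -/
def val (μ : Mem) : Exp → ℕ
  | lit c => c
  | reg x => μ.reg x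
  | get a i => μ.arr a (i.val μ)
  | add u v => u.val μ + v.val μ
  | sub u v => u.val μ - v.val μ
  | half u => u.val μ / 2

/-- The number of elementary operations of an evaluation. -/
def cost : Exp → ℕ
  | lit _ => 1
  | reg _ => 1
  | get _ i => i.cost + 1
  | add u v => u.cost + v.cost + 1
  | sub u v => u.cost + v.cost + 1
  | half u => u.cost + 1

end Exp

/-- Tests. -/
inductive Test where
  | lt (u v : Exp)
  | keyLt (u v : Exp)
  | neg (b : Test)
  | and (b c : Test)

namespace Test

/-- The test succeeds. -/
def Holds (key : ℕ → ℝ) (μ : Mem) : Test → Prop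
  | lt u v => u.val μ < v.val μ
  | keyLt u v => key (u.val μ) < key (v.val μ)
  | neg b => ¬ b.Holds key μ
  | and b c => b.Holds key μ ∧ c.Holds key μ

/-- The number of elementary operations of a test. -/
def cost : Test → ℕ
  | lt u v => u.cost + v.cost + 1
  | keyLt u v => u.cost + v.cost + 1
  | neg b => b.cost + 1
  | and b c => b.cost + c.cost + 1

end Test

/-- Programs. -/
inductive Prog where
  | skip
  | set (x : ℕ) (u : Exp)
  | put (a : ℕ) (i u : Exp)
  | seq (P Q : Prog)
  | ite (b : Test) (P Q : Prog)
  | loop (b : Test) (P : Prog)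

/-- `Exec key P μ t μ'`: the program `P`, started with memory `μ`, halts after `t` elementary steps
with memory `μ'`. -/
inductive Exec (key : ℕ → ℝ) : Prog → Mem → ℕ → Mem → Prop where
  | skip (μ : Mem) : Exec key .skip μ 1 μ
  | set (x : ℕ) (u : Exp) (μ : Mem) :
      Exec key (.set x u) μ (u.cost + 1) { μ with reg := Function.update μ.reg x (u.val μ) }
  | put (a : ℕ) (i u : Exp) (μ : Mem) :
      Exec key (.put a i u) μ (i.cost + u.cost + 1)
        { μ with
          arr := Function.update μ.arr a (Function.update (μ.arr a) (i.val μ) (u.val μ)) }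
  | seq {P Q : Prog} {μ₁ μ₂ μ₃ : Mem} {t₁ t₂ : ℕ} :
      Exec key P μ₁ t₁ μ₂ → Exec key Q μ₂ t₂ μ₃ → Exec key (.seq P Q) μ₁ (t₁ + t₂) μ₃
  | iteTrue {b : Test} {P Q : Prog} {μ₁ μ₂ : Mem} {t : ℕ} :
      b.Holds key μ₁ → Exec key P μ₁ t μ₂ → Exec key (.ite b P Q) μ₁ (b.cost + 1 + t) μ₂
  | iteFalse {b : Test} {P Q : Prog} {μ₁ μ₂ : Mem} {t : ℕ} :
      ¬ b.Holds key μ₁ → Exec key Q μ₁ t μ₂ → Exec key (.ite b P Q) μ₁ (b.cost + 1 + t) μ₂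
  | loopTrue {b : Test} {P : Prog} {μ₁ μ₂ μ₃ : Mem} {t₁ t₂ : ℕ} :
      b.Holds key μ₁ → Exec key P μ₁ t₁ μ₂ → Exec key (.loop b P) μ₂ t₂ μ₃ →
        Exec key (.loop b P) μ₁ (b.cost + 1 + t₁ + t₂) μ₃
  | loopFalse {b : Test} {P : Prog} {μ : Mem} :
      ¬ b.Holds key μ → Exec key (.loop b P) μ (b.cost + 1) μ

end RAM

/-! ### Input and output of the machine -/

namespace FBAP

variable {n : ℕ}

/-- The endpoints, as given to the machine: `s 0, …, s (n-1), e 0, …, e (n-1)`. -/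
noncomputable def key (I : FBAP n) (j : ℕ) : ℝ :=
  if h : j < n then I.s ⟨j, h⟩ else if h : j - n < n then I.e ⟨j - n, h⟩ else 0

/-- The initial memory: `n` and `W` in registers `0` and `1`, the bounds `rmin` and `rmax` in
arrays `0` and `1`, and zero everywhere else. -/
def input (I : FBAP n) : RAM.Mem where
  reg := fun x => if x = 0 then n else if x = 1 then I.W else 0
  arr := fun a j =>
    if h : j < n then
      if a = 0 then I.rmin ⟨j, h⟩ else if a = 1 then I.rmax ⟨j, h⟩ else 0
    else 0

end FBAP

/-- An elementary operation on the color sets as a triple of numbers: source, target (`0` for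
`AVAIL`, `i + 1` for job `i`) and number of colors (`0` for a release). -/
def ColorOp.code {n : ℕ} : ColorOp n → ℕ × ℕ × ℕ
  | .take i m => (0, (i : ℕ) + 1, m)
  | .move k i m => ((k : ℕ) + 1, (i : ℕ) + 1, m)
  | .release i => ((i : ℕ) + 1, 0, 0)

/-- The memory `μ` describes the color sets that Paging_FBA returns for the scan order `L`:
register `2` holds their total size and array `2` their sizes; register `3` and arrays `3`, `4`,
`5` hold a list of elementary operations that produces these very sets, whatever the rule by which
the colors to be moved are picked. -/
def FBAP.IsOutput {n : ℕ} (I : FBAP n) (L : List (Endpoint n)) (μ : RAM.Mem) : Prop :=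
  ∃ ops : List (ColorOp n),
    μ.reg 3 = ops.length ∧
    (∀ j (h : j < ops.length), (μ.arr 3 j, μ.arr 4 j, μ.arr 5 j) = (ops[j]).code) ∧
    ∀ pick, IsPick pick →
      (ops.foldl (FBAState.apply pick) I.initState).A = I.pagingFBA pick L ∧
      (∀ i : Fin n, μ.arr 2 i = (I.pagingFBA pick L i).card) ∧
      μ.reg 2 = ∑ i, (I.pagingFBA pick L i).card

/-! Part (a). The cardinalities evolve independently of the picking rule, and overlapping jobs
always hold disjoint subsets of {1, …, W}, so the counts respect the capacity at every time
(`Tracks`, `Tracks.cap`). The lower bounds come from feasibility: if job i could not reach its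
minimum, AVAIL would be empty and every other job active at `s i` would be down to its minimum, so
any allocation would need more than W units at `s i` (`Tracks.leftSpec`).

Optimality is an exchange argument with the invariant `Dominates`: any allocation can be changed,
without changing its total, into one that lies pointwise below the algorithm's counts on the jobs
scanned so far. After the last endpoint this bounds the total of every allocation. Suppose that i is
scanned and the modified allocation y exceeds the new counts at a job a. Then a has just lost
colors, or a = i stayed below its maximum. In both cases AVAIL is empty and, because colors are
taken from the furthest right endpoint first, every active job above its minimum ends no later than
a. The active jobs hold exactly W units, while y gives them at most W, so y gives some active l less
than the algorithm does. Shift one unit of y from a to l. From `s i` on, l is active only where a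
is; before `s i` the modified y stays below the old counts, which respect the capacity. The excess
of y over the counts drops, so the process ends (`IsAllocation.exchange`, `LeftSpec.dominates`).

Part (b). One tournament tree sorts the endpoints. A second one is a priority queue of the active
jobs above their minimum, keyed by the place of the right endpoint. Both reassignment loops take
from its root; the second one stops when the root does not lie beyond the right endpoint of i. A
move either brings its source down to the minimum, whereupon the source leaves the queue for good,
or satisfies i. Hence there are O(n) nonzero moves, each with one O(log n) update at most; the
accounting uses a potential proportional to the size of the queue (`Rep.runs_moveLoop`). The emitted
operations depend on the counts only, and `foldl_scan` shows that they reproduce the algorithm's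
sets for every picking rule. -/

/-- The numbers of colors in a state of the algorithm. -/
@[ext] structure NumState (n : ℕ) where
  av : ℕ
  x : Fin n → ℕ

namespace NumState

variable {n : ℕ}

/-- The effect of an elementary operation on the numbers of colors. -/
def apply (ν : NumState n) : ColorOp n → NumState n
  | .take i m => { av := ν.av - m, x := Function.update ν.x i (ν.x i + m) }
  | .move k i m =>
      { av := ν.av
        x := Function.update (Function.update ν.x k (ν.x k - m)) i (ν.x i + m) }
  | .release i => { av := ν.av + ν.x i, x := ν.x }

end NumState

/-! ### The list of elementary operations, computed from counts alone -/

namespace FBAP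

variable {n : ℕ}

/-- The initial numbers of colors. -/
def initNum (I : FBAP n) : NumState n where
  av := I.W
  x := fun _ => 0

/-- The nonzero moves of a reassignment loop. -/
def moveOps (I : FBAP n) (i : Fin n) (r : ℕ) : List (Fin n) → NumState n → List (ColorOp n)
  | [], _ => []
  | k :: ks, ν =>
    if min (ν.x k - I.rmin k) (r - ν.x i) = 0 then I.moveOps i r ks ν
    else .move k i (min (ν.x k - I.rmin k) (r - ν.x i)) ::
      I.moveOps i r ks (ν.apply (.move k i (min (ν.x k - I.rmin k) (r - ν.x i))))

/-- The state after a reassignment loop. -/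
def moveNum (I : FBAP n) (i : Fin n) (r : ℕ) (ks : List (Fin n)) (ν : NumState n) : NumState n :=
  (I.moveOps i r ks ν).foldl NumState.apply ν

/-- The first operation at a left endpoint. -/
def takeMin (I : FBAP n) (i : Fin n) (ν : NumState n) : ColorOp n :=
  .take i (min ν.av (I.rmin i))

/-- The second operation of type `take` at a left endpoint. -/
def takeMax (I : FBAP n) (i : Fin n) (ν : NumState n) : ColorOp n :=
  .take i (min ν.av (I.rmax i - I.rmin i))

/-- The operations at an endpoint. -/
def scanOps (I : FBAP n) (L : List (Endpoint n)) (ν : NumState n) : Endpoint n → List (ColorOp n)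
  | .left i =>
    let ν₁ := ν.apply (I.takeMin i ν)
    let ν₂ := I.moveNum i (I.rmin i) (candidates L i (.left i)) ν₁
    let ν₃ := ν₂.apply (I.takeMax i ν₂)
    I.takeMin i ν :: (I.moveOps i (I.rmin i) (candidates L i (.left i)) ν₁ ++
      I.takeMax i ν₂ :: I.moveOps i (I.rmax i) (candidates L i (.right i)) ν₃)
  | .right i => [.release i]

/-- The numbers of colors after a list of operations. -/
def exec (I : FBAP n) (ops : List (ColorOp n)) : NumState n := ops.foldl NumState.apply I.initNum

/-- The operations for the endpoints of a prefix of `L`. -/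
def allOps (I : FBAP n) (L : List (Endpoint n)) (L' : List (Endpoint n)) : List (ColorOp n) :=
  L'.foldl (fun ops ep => ops ++ I.scanOps L (I.exec ops) ep) []

theorem allOps_append (I : FBAP n) (L L' : List (Endpoint n)) (ep : Endpoint n) :
    I.allOps L (L' ++ [ep]) =
      I.allOps L L' ++ I.scanOps L (I.exec (I.allOps L L')) ep := by
  simp [allOps, List.foldl_append]

theorem exec_append (I : FBAP n) (o o' : List (ColorOp n)) :
    I.exec (o ++ o') = o'.foldl NumState.apply (I.exec o) := by
  simp [exec, List.foldl_append]

theorem foldl_scanOps_left (I : FBAP n) (L : List (Endpoint n)) (ν : NumState n) (i : Fin n) :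
    (I.scanOps L ν (.left i)).foldl NumState.apply ν =
      (let ν₁ := ν.apply (I.takeMin i ν)
       let ν₂ := I.moveNum i (I.rmin i) (candidates L i (.left i)) ν₁
       let ν₃ := ν₂.apply (I.takeMax i ν₂)
       I.moveNum i (I.rmax i) (candidates L i (.right i)) ν₃) := by
  simp [scanOps, List.foldl_append, moveNum]

end FBAP

/-! ### Places in the scan order -/

/-- The place of the left endpoint of `k` in the scan order. -/
def lpos {n : ℕ} (L : List (Endpoint n)) (k : Fin n) : ℕ := L.idxOf (Endpoint.left k)

/-- The place of the right endpoint of `k` in the scan order. -/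
def rpos {n : ℕ} (L : List (Endpoint n)) (k : Fin n) : ℕ := L.idxOf (Endpoint.right k)

namespace FBAP.IsScanOrder

variable {n : ℕ} {I : FBAP n} {L : List (Endpoint n)}

theorem idxOf_lt (h : I.IsScanOrder L) (a : Endpoint n) : L.idxOf a < L.length :=
  List.idxOf_lt_length_iff.2 (h.2.1 a)

theorem idxOf_inj (h : I.IsScanOrder L) {a b : Endpoint n} : L.idxOf a = L.idxOf b ↔ a = b :=
  List.idxOf_inj (h.2.1 a)

theorem mayPrecede (h : I.IsScanOrder L) {a b : Endpoint n} (hab : L.idxOf a < L.idxOf b) :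
    a.MayPrecede I b := by
  have := List.pairwise_iff_getElem.1 h.2.2 _ _ (h.idxOf_lt a) (h.idxOf_lt b) hab
  simpa using this

theorem lpos_inj (h : I.IsScanOrder L) {i j : Fin n} : lpos L i = lpos L j ↔ i = j := by
  simp [lpos, h.idxOf_inj]

theorem rpos_inj (h : I.IsScanOrder L) {i j : Fin n} : rpos L i = rpos L j ↔ i = j := by
  simp [rpos, h.idxOf_inj]

theorem lpos_ne_rpos (h : I.IsScanOrder L) (i j : Fin n) : lpos L i ≠ rpos L j := by
  simp [lpos, rpos, h.idxOf_inj]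

theorem s_le_s (h : I.IsScanOrder L) {i j : Fin n} (hij : lpos L i ≤ lpos L j) :
    I.s i ≤ I.s j := by
  rcases hij.lt_or_eq with hij | hij
  · rcases h.mayPrecede hij with h | h
    · exact h.le
    · exact h.1.le
  · rw [h.lpos_inj.1 hij]

theorem e_le_e (h : I.IsScanOrder L) {i j : Fin n} (hij : rpos L i ≤ rpos L j) :
    I.e i ≤ I.e j := by
  rcases hij.lt_or_eq with hij | hij
  · rcases h.mayPrecede hij with h | h
    · exact h.le
    · exact h.1.le
  · rw [h.rpos_inj.1 hij]

theorem lpos_lt_of_s_lt (h : I.IsScanOrder L) {i j : Fin n} (hij : I.s i < I.s j) :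
    lpos L i < lpos L j := by
  by_contra hc
  exact absurd (h.s_le_s (not_lt.1 hc)) (not_le.2 hij)

/-- The tie rule (right endpoints before left ones) matches the half-open intervals: a left and a
right endpoint compare in the list exactly as strictly as on the line. Hence two intervals meet if
and only if their places interleave, and all later arguments can work with places. -/
theorem lpos_lt_rpos_iff (h : I.IsScanOrder L) {i j : Fin n} :
    lpos L i < rpos L j ↔ I.s i < I.e j := by
  constructor
  · intro hij
    rcases h.mayPrecede hij with h | h
    · exact h
    · exact absurd ⟨rfl, rfl⟩ (h.2 i j)
  · intro hij
    by_contra hc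
    have hc' : rpos L j < lpos L i := lt_of_le_of_ne (not_lt.1 hc) (h.lpos_ne_rpos i j).symm
    rcases h.mayPrecede hc' with h | h
    · exact lt_asymm h hij
    · exact hij.ne' h.1

theorem lpos_lt_rpos (h : I.IsScanOrder L) (i : Fin n) : lpos L i < rpos L i :=
  h.lpos_lt_rpos_iff.2 (I.s_lt_e i)

theorem mem_candidates_left (h : I.IsScanOrder L) {i k : Fin n} :
    k ∈ candidates L i (.left i) ↔ lpos L k < lpos L i ∧ lpos L i < rpos L k := by
  simp only [candidates, lpos, rpos, List.mem_filter, List.mem_filterMap, List.mem_reverse,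
    decide_eq_true_eq, and_iff_right_iff_imp]
  exact fun _ => ⟨.right k, h.2.1 _, rfl⟩

theorem mem_candidates_right (h : I.IsScanOrder L) {i k : Fin n} :
    k ∈ candidates L i (.right i) ↔ lpos L k < lpos L i ∧ rpos L i < rpos L k := by
  simp only [candidates, lpos, rpos, List.mem_filter, List.mem_filterMap, List.mem_reverse,
    decide_eq_true_eq, and_iff_right_iff_imp]
  exact fun _ => ⟨.right k, h.2.1 _, rfl⟩

theorem pairwise_idxOf (h : I.IsScanOrder L) : L.Pairwise (fun a b => L.idxOf a < L.idxOf b) := by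
  rw [List.pairwise_iff_getElem]
  intro a b ha hb hab
  rwa [h.1.idxOf_getElem, h.1.idxOf_getElem]

theorem candidates_pairwise (h : I.IsScanOrder L) (i : Fin n) (a : Endpoint n) :
    (candidates L i a).Pairwise (fun k l => rpos L l < rpos L k) := by
  refine List.Pairwise.filter _ ?_
  rw [List.pairwise_filterMap]
  rw [List.pairwise_reverse]
  refine h.pairwise_idxOf.imp ?_
  rintro a b hab k hk l hl
  cases a <;> cases b <;> simp_all [Endpoint.rightJob, rpos]

end FBAP.IsScanOrder

/-! ### Color sets and their cardinalities -/

/-- The color sets of a state fit the numbers `ν`, and they are as disjoint as they should be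
when `q` endpoints have been scanned. -/
structure FBAP.Tracks {n : ℕ} (I : FBAP n) (L : List (Endpoint n)) (q : ℕ) (σ : FBAState n)
    (ν : NumState n) : Prop where
  card_avail : σ.avail.card = ν.av
  card_A : ∀ i, (σ.A i).card = ν.x i
  avail_sub : σ.avail ⊆ Finset.Icc 1 I.W
  A_sub : ∀ i, σ.A i ⊆ Finset.Icc 1 I.W
  disj_avail : ∀ k, q ≤ rpos L k → Disjoint σ.avail (σ.A k)
  disj : ∀ i j, i ≠ j → lpos L i < rpos L j → lpos L j < rpos L i → Disjoint (σ.A i) (σ.A j)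
  empty : ∀ k, q ≤ lpos L k → σ.A k = ∅
  total : ν.av + ∑ k with q ≤ rpos L k, ν.x k = I.W

namespace FBAP.Tracks

variable {n : ℕ} {I : FBAP n} {L : List (Endpoint n)} {q : ℕ} {σ : FBAState n} {ν : NumState n}
  {pick : Finset ℕ → ℕ → Finset ℕ}

theorem init (I : FBAP n) (L : List (Endpoint n)) : I.Tracks L 0 I.initState I.initNum where
  card_avail := by simp [initState, initNum]
  card_A := by simp [initState, initNum]
  avail_sub := by simp [initState]
  A_sub := by simp [initState]
  disj_avail := by simp [initState]
  disj := by simp [initState]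
  empty := by simp [initState]
  total := by simp [initNum]

theorem take (h : I.Tracks L q σ ν) (hp : IsPick pick) (i : Fin n) (m : ℕ) (hm : m ≤ ν.av)
    (hq : q = lpos L i + 1) (hi : lpos L i < rpos L i) :
    I.Tracks L q (σ.apply pick (.take i m)) (ν.apply (.take i m)) := by
  obtain ⟨hS, hSc⟩ := hp σ.avail m (by rw [h.card_avail]; exact hm)
  have hSi : Disjoint (σ.A i) (pick σ.avail m) :=
    ((h.disj_avail i (by omega)).mono_left hS).symm
  refine ⟨?_, ?_, ?_, ?_, ?_, ?_, ?_, ?_⟩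
  · simp only [FBAState.apply, NumState.apply]
    rw [Finset.card_sdiff_of_subset hS, hSc, h.card_avail]
  · intro j
    simp only [FBAState.apply, NumState.apply, Function.update_apply]
    split_ifs with hj
    · rw [Finset.card_union_of_disjoint hSi, hSc, h.card_A]
    · exact h.card_A j
  · exact Finset.sdiff_subset.trans h.avail_sub
  · intro j
    simp only [FBAState.apply, Function.update_apply]
    split_ifs with hj
    · exact Finset.union_subset (h.A_sub i) (hS.trans h.avail_sub)
    · exact h.A_sub j
  · intro k hk
    simp only [FBAState.apply, Function.update_apply]
    split_ifs with hj
    · subst hj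
      exact Finset.disjoint_union_right.2
        ⟨(h.disj_avail k hk).mono_left Finset.sdiff_subset, Finset.sdiff_disjoint⟩
    · exact (h.disj_avail k hk).mono_left Finset.sdiff_subset
  · intro a b hab h1 h2
    simp only [FBAState.apply, Function.update_apply]
    split_ifs with ha hb hb
    · exact absurd (ha.trans hb.symm) hab
    · subst ha
      exact Finset.disjoint_union_left.2
        ⟨h.disj a b hab h1 h2, (h.disj_avail b (by omega)).mono_left hS⟩
    · subst hb
      exact Finset.disjoint_union_right.2
        ⟨h.disj a b hab h1 h2, ((h.disj_avail a (by omega)).mono_left hS).symm⟩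
    · exact h.disj a b hab h1 h2
  · intro k hk
    simp only [FBAState.apply, Function.update_apply]
    rw [if_neg (by rintro rfl; omega)]
    exact h.empty k hk
  · have := h.total
    simp only [NumState.apply]
    rw [Finset.sum_update_of_mem (by simp; omega)]
    rw [← Finset.add_sum_erase _ _ (show i ∈ _ by simp; omega), ← Finset.sdiff_singleton_eq_erase]
      at this
    omega

/-- The colors that i receives from k cannot clash with a third job j that overlaps i: if j has
started, then j and k are both active at `s i`, so their sets were disjoint; otherwise j holds
nothing yet. -/
theorem move (h : I.Tracks L q σ ν) (hp : IsPick pick) (k i : Fin n) (m : ℕ) (hm : m ≤ ν.x k)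
    (hq : q = lpos L i + 1) (hi : lpos L i < rpos L i) (hk : lpos L k < lpos L i)
    (hk' : lpos L i < rpos L k) :
    I.Tracks L q (σ.apply pick (.move k i m)) (ν.apply (.move k i m)) := by
  obtain ⟨hS, hSc⟩ := hp (σ.A k) m (by rw [h.card_A]; exact hm)
  have hki : k ≠ i := by rintro rfl; omega
  have hSi : Disjoint (σ.A i) (pick (σ.A k) m) :=
    ((h.disj i k hki.symm (by omega) (by omega)).mono_right hS)
  have key : ∀ j, j ≠ i → j ≠ k → lpos L i < rpos L j → Disjoint (pick (σ.A k) m) (σ.A j) := by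
    intro j hj hjk h1
    by_cases h2 : lpos L j < q
    · exact (h.disj k j hjk.symm (by omega) (by omega)).mono_left hS
    · rw [h.empty j (by omega)]; simp
  refine ⟨?_, ?_, ?_, ?_, ?_, ?_, ?_, ?_⟩
  · exact h.card_avail
  · intro j
    simp only [FBAState.apply, NumState.apply, Function.update_apply]
    split_ifs with hj hj
    · rw [Finset.card_union_of_disjoint hSi, hSc, h.card_A]
    · rw [Finset.card_sdiff_of_subset hS, hSc, h.card_A]
    · exact h.card_A j
  · exact h.avail_sub
  · intro j
    simp only [FBAState.apply, Function.update_apply]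
    split_ifs with hj
    · exact Finset.union_subset (h.A_sub i) (hS.trans (h.A_sub k))
    · exact Finset.sdiff_subset.trans (h.A_sub k)
    · exact h.A_sub j
  · intro j hj
    simp only [FBAState.apply, Function.update_apply]
    split_ifs with hji
    · subst hji
      exact Finset.disjoint_union_right.2
        ⟨h.disj_avail j hj, (h.disj_avail k (by omega)).mono_right hS⟩
    · exact (h.disj_avail k (by omega)).mono_right Finset.sdiff_subset
    · exact h.disj_avail j hj
  · intro a b hab h1 h2
    simp only [FBAState.apply, Function.update_apply]
    split_ifs with ha hb hb hb hb hb hb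
    · exact absurd (ha.trans hb.symm) hab
    · subst ha
      refine Finset.disjoint_union_left.2 ⟨?_, Finset.disjoint_sdiff⟩
      exact (h.disj a k hki.symm (by omega) (by omega)).mono_right Finset.sdiff_subset
    · subst ha
      exact Finset.disjoint_union_left.2 ⟨h.disj a b hab h1 h2, key b hb ‹_› h1⟩
    · subst hb
      refine Finset.disjoint_union_right.2 ⟨?_, Finset.sdiff_disjoint⟩
      exact (h.disj k b hki (by omega) (by omega)).mono_left Finset.sdiff_subset
    · exact absurd (‹a = k›.trans ‹b = k›.symm) hab
    · rw [← ‹a = k›]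
      exact (h.disj a b hab h1 h2).mono_left Finset.sdiff_subset
    · subst hb
      exact Finset.disjoint_union_right.2 ⟨h.disj a b hab h1 h2, (key a ha ‹_› h2).symm⟩
    · rw [← ‹b = k›]
      exact (h.disj a b hab h1 h2).mono_right Finset.sdiff_subset
    · exact h.disj a b hab h1 h2
  · intro j hj
    simp only [FBAState.apply, Function.update_apply]
    rw [if_neg (by rintro rfl; omega), if_neg (by rintro rfl; omega)]
    exact h.empty j hj
  · have := h.total
    simp only [NumState.apply]
    rw [Finset.sum_update_of_mem (by simp; omega), Finset.sum_update_of_mem (by simp [hki]; omega)]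
    rw [← Finset.add_sum_erase _ _ (show i ∈ _ by simp; omega), ← Finset.sdiff_singleton_eq_erase,
      ← Finset.add_sum_erase _ _ (show k ∈ _ by simp [hki]; omega),
      ← Finset.sdiff_singleton_eq_erase] at this
    omega

/-- An unfinished job either started before the right endpoint of i, and then overlaps i, or has no
colors yet; so the released colors are disjoint from its set. The set of i itself is kept as output,
which is why disjointness from AVAIL is only demanded for unfinished jobs. -/
theorem release (h : I.Tracks L q σ ν) (hL : I.IsScanOrder L) (i : Fin n) (hq : q = rpos L i) :
    I.Tracks L (q + 1) (σ.apply pick (.release i)) (ν.apply (.release i)) := by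
  have hne : ∀ k, q + 1 ≤ rpos L k → i ≠ k := by rintro k hk rfl; omega
  refine ⟨?_, h.card_A, ?_, h.A_sub, ?_, h.disj, fun k hk => h.empty k (by omega), ?_⟩
  · simp only [FBAState.apply, NumState.apply]
    rw [Finset.card_union_of_disjoint (h.disj_avail i hq.le), h.card_avail, h.card_A]
  · exact Finset.union_subset h.avail_sub (h.A_sub i)
  · intro k hk
    refine Finset.disjoint_union_left.2 ⟨h.disj_avail k (by omega), ?_⟩
    by_cases hk' : lpos L k < rpos L i
    · exact h.disj i k (hne k hk) ((hL.lpos_lt_rpos i).trans (by omega)) hk'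
    · change Disjoint (σ.A i) (σ.A k)
      rw [h.empty k (by omega)]; simp
  · have := h.total
    have e : (Finset.univ.filter fun k => q ≤ rpos L k) =
        insert i (Finset.univ.filter fun k => q + 1 ≤ rpos L k) := by
      ext k
      simp only [Finset.mem_filter, Finset.mem_univ, true_and, Finset.mem_insert]
      constructor
      · intro hk
        rcases hk.lt_or_eq with hk | hk
        · exact Or.inr hk
        · exact Or.inl (hL.rpos_inj.1 (by omega))
      · rintro (rfl | hk) <;> omega
    rw [e, Finset.sum_insert (by simp; omega)] at this
    simp only [NumState.apply]
    omega

theorem left (h : I.Tracks L q σ ν) (hL : I.IsScanOrder L) (i : Fin n) (hq : q = lpos L i) :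
    I.Tracks L (q + 1) σ ν := by
  have hr : ∀ k, q ≤ rpos L k ↔ q + 1 ≤ rpos L k := by
    intro k
    have := hL.lpos_ne_rpos i k
    omega
  refine ⟨h.card_avail, h.card_A, h.avail_sub, h.A_sub, fun k hk => h.disj_avail k (by omega),
    h.disj, fun k hk => h.empty k (by omega), ?_⟩
  simpa only [hr] using h.total

end FBAP.Tracks

namespace FBAState

variable {n : ℕ} {pick : Finset ℕ → ℕ → Finset ℕ}

theorem apply_move_zero (hp : IsPick pick) (σ : FBAState n) (k i : Fin n) :
    σ.apply pick (.move k i 0) = σ := by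
  have h0 : pick (σ.A k) 0 = ∅ := Finset.card_eq_zero.1 (hp _ 0 (Nat.zero_le _)).2
  simp [apply, h0]

end FBAState

namespace FBAP.Tracks

variable {n : ℕ} {I : FBAP n} {L : List (Endpoint n)} {q : ℕ} {σ : FBAState n} {ν : NumState n}
  {pick : Finset ℕ → ℕ → Finset ℕ}

theorem reassign (hp : IsPick pick) (i : Fin n) (r : ℕ)
    (hq : q = lpos L i + 1) (hi : lpos L i < rpos L i) (ks : List (Fin n))
    (hks : ∀ k ∈ ks, lpos L k < lpos L i ∧ lpos L i < rpos L k) (σ : FBAState n) (ν : NumState n)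
    (h : I.Tracks L q σ ν) :
    I.reassign pick i r ks σ = (I.moveOps i r ks ν).foldl (FBAState.apply pick) σ ∧
      I.Tracks L q (I.reassign pick i r ks σ) (I.moveNum i r ks ν) := by
  induction ks generalizing σ ν with
  | nil => exact ⟨rfl, h⟩
  | cons k ks ih =>
    have hk := hks k (by simp)
    have hks' : ∀ k ∈ ks, lpos L k < lpos L i ∧ lpos L i < rpos L k :=
      fun l hl => hks l (by simp [hl])
    have e : I.reassign pick i r (k :: ks) σ = I.reassign pick i r ks
        (σ.apply pick (.move k i (min (ν.x k - I.rmin k) (r - ν.x i)))) := by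
      simp [FBAP.reassign, h.card_A]
    rw [e]
    -- The loop visits all candidates, most of them with a move of zero colors. Such moves change
    -- nothing and are omitted from the operation list, which must be short enough to be written
    -- within the time bound.
    by_cases h0 : min (ν.x k - I.rmin k) (r - ν.x i) = 0
    · simp only [moveNum, moveOps, if_pos h0]
      rw [h0, FBAState.apply_move_zero hp]
      exact ih hks' σ ν h
    · simp only [moveNum, moveOps, if_neg h0, List.foldl_cons]
      exact ih hks' _ _ (h.move hp k i _ (by omega) hq hi hk.1 hk.2)

theorem scan (hp : IsPick pick) (hL : I.IsScanOrder L) (h : I.Tracks L q σ ν) (ep : Endpoint n)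
    (hq : q = L.idxOf ep) :
    I.scan pick L σ ep = (I.scanOps L ν ep).foldl (FBAState.apply pick) σ ∧
      I.Tracks L (q + 1) (I.scan pick L σ ep) ((I.scanOps L ν ep).foldl NumState.apply ν) := by
  cases ep with
  | right i => exact ⟨rfl, h.release (pick := pick) hL i hq⟩
  | left i =>
    have hi := hL.lpos_lt_rpos i
    have hq' : q + 1 = lpos L i + 1 := by rw [hq]; rfl
    have h0 := h.left hL i hq
    have h1 := h0.take hp i (min ν.av (I.rmin i)) (by omega) hq' hi
    have h2 := reassign hp i (I.rmin i) hq' hi (candidates L i (.left i))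
      (fun k hk => hL.mem_candidates_left.1 hk) _ _ h1
    have h3 := h2.2.take hp i _ (min_le_left _ (I.rmax i - I.rmin i)) hq' hi
    have h4 := reassign hp i (I.rmax i) hq' hi (candidates L i (.right i))
      (fun k hk => by have := hL.mem_candidates_right.1 hk; omega) _ _ h3
    rw [foldl_scanOps_left]
    simp only [FBAP.scan, scanOps, List.foldl_cons, List.foldl_append, takeMin, takeMax]
    rw [h0.card_avail, ← h2.1, h2.2.card_avail, ← h4.1]
    exact ⟨rfl, h4.2⟩

end FBAP.Tracks

namespace FBAP

variable {n : ℕ} {I : FBAP n} {L : List (Endpoint n)} {pick : Finset ℕ → ℕ → Finset ℕ}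

theorem IsScanOrder.idxOf_of_prefix (hL : I.IsScanOrder L) {L' : List (Endpoint n)}
    {ep : Endpoint n} (hpre : L' ++ [ep] <+: L) : L.idxOf ep = L'.length := by
  obtain ⟨t, rfl⟩ := hpre
  have h1 := hL.1
  rw [List.append_assoc, List.idxOf_append_of_notMem]
  · simp
  · intro hmem
    simp only [List.append_assoc, List.nodup_append] at h1
    exact h1.2.2 _ hmem _ (by simp) rfl

/-- The list `allOps` does not mention `pick`: one list of operations reproduces the run for every
picking rule. Part (a) uses the invariant, part (b) the equality. -/
theorem foldl_scan (hp : IsPick pick) (hL : I.IsScanOrder L) (L' : List (Endpoint n))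
    (hpre : L' <+: L) :
    L'.foldl (I.scan pick L) I.initState =
        (I.allOps L L').foldl (FBAState.apply pick) I.initState ∧
      I.Tracks L L'.length (L'.foldl (I.scan pick L) I.initState) (I.exec (I.allOps L L')) := by
  induction L' using List.reverseRecOn with
  | nil => exact ⟨rfl, Tracks.init I L⟩
  | append_singleton L' ep ih =>
    obtain ⟨e, h⟩ := ih ((List.prefix_append _ _).trans hpre)
    have := Tracks.scan hp hL h ep (hL.idxOf_of_prefix hpre).symm
    rw [allOps_append, exec_append]
    simp only [List.foldl_append, List.foldl_cons, List.foldl_nil, List.length_append,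
      List.length_singleton]
    rw [this.1, ← e, ← this.1]
    exact ⟨rfl, this.2⟩

end FBAP

/-! ### What one left endpoint does to the counts -/

namespace FBAP

variable {n : ℕ} {I : FBAP n} {L : List (Endpoint n)}

theorem _root_.NumState.apply_move_zero (ν : NumState n) (k i : Fin n) :
    ν.apply (.move k i 0) = ν := by
  simp [NumState.apply]

theorem moveNum_cons (I : FBAP n) (i : Fin n) (r : ℕ) (k : Fin n) (ks : List (Fin n))
    (ν : NumState n) : I.moveNum i r (k :: ks) ν =
      I.moveNum i r ks (ν.apply (.move k i (min (ν.x k - I.rmin k) (r - ν.x i)))) := by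
  by_cases h0 : min (ν.x k - I.rmin k) (r - ν.x i) = 0
  · simp only [moveNum, moveOps, if_pos h0]
    rw [h0, NumState.apply_move_zero]
  · simp only [moveNum, moveOps, if_neg h0, List.foldl_cons]

/-- What a reassignment loop does to the numbers of colors. -/
structure MoveSpec (I : FBAP n) (L : List (Endpoint n)) (i : Fin n) (r : ℕ) (ks : List (Fin n))
    (ν ν' : NumState n) : Prop where
  av : ν'.av = ν.av
  le : ∀ k, k ≠ i → ν'.x k ≤ ν.x k
  eq : ∀ k, k ≠ i → k ∉ ks → ν'.x k = ν.x k
  rmin_le : ∀ k, k ≠ i → I.rmin k ≤ ν.x k → I.rmin k ≤ ν'.x k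
  ge_i : ν.x i ≤ ν'.x i
  le_i : ν'.x i ≤ max r (ν.x i)
  done : ν'.x i < r → ∀ k ∈ ks, ν'.x k ≤ I.rmin k
  lt : ∀ a, a ≠ i → ν'.x a < ν.x a →
    ν.x i < r ∧ ∀ l ∈ ks, I.rmin l < ν'.x l → rpos L l ≤ rpos L a
  inc : ν.x i < ν'.x i → ∃ k ∈ ks, ν'.x k < ν.x k

/-- The greedy order is captured by the field `lt`: colors are taken from a job only after all
candidates with further right endpoints have been brought down to their minima. -/
theorem moveNum_spec (I : FBAP n) (L : List (Endpoint n)) (i : Fin n) (r : ℕ)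
    (ks : List (Fin n)) (hi : i ∉ ks) (hks : ks.Pairwise (fun k l => rpos L l < rpos L k))
    (ν : NumState n) : MoveSpec I L i r ks ν (I.moveNum i r ks ν) := by
  induction ks generalizing ν with
  | nil =>
    refine ⟨rfl, fun _ _ => le_rfl, fun _ _ _ => rfl, fun _ _ h => h, le_rfl, le_max_right _ _,
      fun _ _ h => absurd h (by simp), fun a _ h => absurd h (lt_irrefl _),
      fun h => absurd h (lt_irrefl _)⟩
  | cons k ks ih =>
    rw [moveNum_cons]
    set m := min (ν.x k - I.rmin k) (r - ν.x i) with hm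
    set ν₁ := ν.apply (.move k i m) with hν₁
    have hik : k ≠ i := by rintro rfl; simp at hi
    have hks1 := List.pairwise_cons.1 hks
    have hkks : k ∉ ks := fun h => lt_irrefl _ (hks1.1 k h)
    have h := ih (by simp at hi; exact hi.2) hks1.2 ν₁
    set ν' := I.moveNum i r ks ν₁
    have xi : ν₁.x i = ν.x i + m := by simp [hν₁, NumState.apply]
    have xk : ν₁.x k = ν.x k - m := by simp [hν₁, NumState.apply, hik]
    have xo : ∀ a, a ≠ i → a ≠ k → ν₁.x a = ν.x a := by
      intro a h1 h2; simp [hν₁, NumState.apply, h1, h2]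
    have xk' : ν'.x k = ν.x k - m := by rw [h.eq k hik hkks, xk]
    have hle : ∀ a, a ≠ i → ν₁.x a ≤ ν.x a := by
      intro a h1
      by_cases h2 : a = k
      · subst h2; omega
      · rw [xo a h1 h2]
    refine ⟨h.av, fun a ha => (h.le a ha).trans (hle a ha), ?_, ?_, ?_, ?_, ?_, ?_, ?_⟩
    · intro a ha hak
      rw [List.mem_cons, not_or] at hak
      rw [h.eq a ha hak.2, xo a ha hak.1]
    · intro a ha hr
      refine h.rmin_le a ha ?_
      by_cases h2 : a = k
      · subst h2; omega
      · rwa [xo a ha h2]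
    · have := h.ge_i
      omega
    · have := h.le_i
      omega
    · intro hlt l hl
      rcases List.mem_cons.1 hl with rfl | hl
      · have := h.ge_i
        omega
      · exact h.done hlt l hl
    · intro a ha hlt
      by_cases hak : a = k
      · subst hak
        refine ⟨by omega, fun l hl hr => ?_⟩
        rcases List.mem_cons.1 hl with rfl | hl
        · exact le_rfl
        · exact (hks1.1 l hl).le
      -- Here a loses colors later than the head k of the list. So i was still short after the move
      -- from k, which means that k gave up its whole surplus and cannot be the l in question.
      · rw [← xo a ha hak] at hlt
        obtain ⟨h1, h2⟩ := h.lt a ha hlt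
        refine ⟨by omega, fun l hl hr => ?_⟩
        rcases List.mem_cons.1 hl with rfl | hl
        · omega
        · exact h2 l hl hr
    · intro hlt
      by_cases h0 : m = 0
      · obtain ⟨l, hl, h3⟩ := h.inc (by omega)
        refine ⟨l, by simp [hl], h3.trans_le (hle l ?_)⟩
        rintro rfl; simp [hl] at hi
      · exact ⟨k, by simp, by omega⟩

theorem IsAllocation.sum_active_le {y : Fin n → ℕ} (hy : I.IsAllocation y)
    (hL : I.IsScanOrder L) (i : Fin n) :
    ∑ k with lpos L k ≤ lpos L i ∧ lpos L i < rpos L k, y k ≤ I.W := by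
  refine le_trans ?_ (hy.2 (I.s i))
  rw [Finset.sum_filter]
  refine Finset.sum_le_sum fun k _ => ?_
  split_ifs with h
  · rw [Set.indicator_of_mem]
    exact ⟨hL.s_le_s h.1, hL.lpos_lt_rpos_iff.1 h.2⟩
  · exact Nat.zero_le _

/-- Unfinished jobs that have not started hold nothing, so AVAIL and the jobs active at `s i` share
all W colors. Equality is what the exchange argument needs. -/
theorem Tracks.sum_active {q : ℕ} {σ : FBAState n} {ν : NumState n} (h : I.Tracks L q σ ν)
    {i : Fin n} (hq : q = lpos L i + 1) :
    ν.av + ∑ k with lpos L k ≤ lpos L i ∧ lpos L i < rpos L k, ν.x k = I.W := by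
  rw [← h.total]
  congr 1
  refine Finset.sum_subset (fun k hk => ?_) (fun k hk hk' => ?_)
  · simp only [Finset.mem_filter, Finset.mem_univ, true_and] at hk ⊢
    omega
  · simp only [Finset.mem_filter, Finset.mem_univ, true_and] at hk hk'
    rw [← h.card_A, h.empty k (by omega), Finset.card_empty]

/-- What the algorithm does to the numbers of colors at the left endpoint of `i`. -/
structure LeftSpec (I : FBAP n) (L : List (Endpoint n)) (i : Fin n) (ν ν' : NumState n) :
    Prop where
  le : ∀ k, k ≠ i → ν'.x k ≤ ν.x k
  bounds : ∀ k, lpos L k ≤ lpos L i → I.rmin k ≤ ν'.x k ∧ ν'.x k ≤ I.rmax k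
  lt : ∀ a, a ≠ i → ν'.x a < ν.x a →
    (lpos L a < lpos L i ∧ lpos L i < rpos L a) ∧ ν'.av = 0 ∧
    ∀ l, lpos L l ≤ lpos L i → lpos L i < rpos L l → I.rmin l < ν'.x l → rpos L l ≤ rpos L a
  lt_rmax : ν'.x i < I.rmax i → ν'.av = 0 ∧
    ∀ l, lpos L l ≤ lpos L i → lpos L i < rpos L l → I.rmin l < ν'.x l → rpos L l ≤ rpos L i

theorem Tracks.leftSpec {q : ℕ} {σ : FBAState n} {ν : NumState n}
    {pick : Finset ℕ → ℕ → Finset ℕ} (hp : IsPick pick) (hL : I.IsScanOrder L) (hI : I.Feasible)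
    (h : I.Tracks L q σ ν) (i : Fin n) (hq : q = lpos L i)
    (hb : ∀ k, lpos L k < lpos L i → I.rmin k ≤ ν.x k ∧ ν.x k ≤ I.rmax k) :
    LeftSpec I L i ν ((I.scanOps L ν (.left i)).foldl NumState.apply ν) := by
  obtain ⟨y, hy⟩ := hI
  rw [foldl_scanOps_left]
  have hi := hL.lpos_lt_rpos i
  have hq' : q + 1 = lpos L i + 1 := by rw [hq]
  have h0 := h.left hL i hq
  have h1 := h0.take hp i (min ν.av (I.rmin i)) (by omega) hq' hi
  have h2 := Tracks.reassign hp i (I.rmin i) hq' hi (candidates L i (.left i))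
    (fun k hk => hL.mem_candidates_left.1 hk) _ _ h1
  have x0 : ν.x i = 0 := by rw [← h.card_A, h.empty i (by omega), Finset.card_empty]
  have S2 := moveNum_spec I L i (I.rmin i) (candidates L i (.left i))
    (fun hk => by have := hL.mem_candidates_left.1 hk; omega) (hL.candidates_pairwise _ _)
    (ν.apply (I.takeMin i ν))
  have av1 : (ν.apply (I.takeMin i ν)).av = ν.av - I.rmin i := by
    simp only [NumState.apply, takeMin]; omega
  have xi1 : (ν.apply (I.takeMin i ν)).x i = min ν.av (I.rmin i) := by
    simp [NumState.apply, takeMin, x0]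
  have xo1 : ∀ k, k ≠ i → (ν.apply (I.takeMin i ν)).x k = ν.x k := by
    intro k hk; simp [NumState.apply, takeMin, hk]
  have T2 : (I.moveNum i (I.rmin i) (candidates L i (.left i)) (ν.apply (I.takeMin i ν))).av +
      ∑ k with lpos L k ≤ lpos L i ∧ lpos L i < rpos L k,
        (I.moveNum i (I.rmin i) (candidates L i (.left i)) (ν.apply (I.takeMin i ν))).x k = I.W :=
    h2.2.sum_active hq'
  dsimp only
  generalize ν.apply (I.takeMin i ν) = ν₁ at *
  generalize I.moveNum i (I.rmin i) (candidates L i (.left i)) ν₁ = ν₂ at *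
  -- Otherwise AVAIL is empty and all active jobs are at most at their minima, i strictly below; the
  -- feasible `y` would then use more than W units at `s i`.
  have xi2 : ν₂.x i = I.rmin i := by
    by_contra hne
    have hle := S2.le_i
    have hge := S2.ge_i
    have hlt : ν₂.x i < I.rmin i := by omega
    have hav : ν₂.av = 0 := by rw [S2.av]; omega
    have hlt' : ∑ k with lpos L k ≤ lpos L i ∧ lpos L i < rpos L k, ν₂.x k <
        ∑ k with lpos L k ≤ lpos L i ∧ lpos L i < rpos L k, y k := by
      refine Finset.sum_lt_sum (fun k hk => ?_)
        ⟨i, by simpa using hi, hlt.trans_le (hy.1 i).1⟩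
      simp only [Finset.mem_filter, Finset.mem_univ, true_and] at hk
      by_cases hki : k = i
      · subst hki
        exact (hlt.trans_le (hy.1 k).1).le
      · refine (S2.done hlt k (hL.mem_candidates_left.2 ⟨?_, hk.2⟩)).trans (hy.1 k).1
        exact lt_of_le_of_ne hk.1 (fun h => hki (hL.lpos_inj.1 h))
    have := hy.sum_active_le hL i
    omega
  have hrr : I.rmin i ≤ I.rmax i := (hy.1 i).1.trans (hy.1 i).2
  have S4 := moveNum_spec I L i (I.rmax i) (candidates L i (.right i))
    (fun hk => by have := hL.mem_candidates_right.1 hk; omega) (hL.candidates_pairwise _ _)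
    (ν₂.apply (I.takeMax i ν₂))
  have av3 : (ν₂.apply (I.takeMax i ν₂)).av = ν₂.av - (I.rmax i - I.rmin i) := by
    simp only [NumState.apply, takeMax]; omega
  have xi3 : (ν₂.apply (I.takeMax i ν₂)).x i = I.rmin i + min ν₂.av (I.rmax i - I.rmin i) := by
    simp [NumState.apply, takeMax, xi2]
  have xo3 : ∀ k, k ≠ i → (ν₂.apply (I.takeMax i ν₂)).x k = ν₂.x k := by
    intro k hk; simp [NumState.apply, takeMax, hk]
  generalize ν₂.apply (I.takeMax i ν₂) = ν₃ at *
  generalize I.moveNum i (I.rmax i) (candidates L i (.right i)) ν₃ = ν₄ at *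
  have le43 := S4.le
  have le21 := S2.le
  have hle : ∀ k, k ≠ i → ν₄.x k ≤ ν.x k := fun k hk => by
    have := le43 k hk; have := le21 k hk; have := xo1 k hk; have := xo3 k hk; omega
  have hlp : ∀ k, lpos L k ≤ lpos L i → k ≠ i → lpos L k < lpos L i := fun k hk hki =>
    lt_of_le_of_ne hk (fun h => hki (hL.lpos_inj.1 h))
  have c2 : ∀ k, k ∈ candidates L i (.left i) ↔ _ := fun k => hL.mem_candidates_left
  have c4 : ∀ k, k ∈ candidates L i (.right i) ↔ _ := fun k => hL.mem_candidates_right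
  have g4 := S4.ge_i
  have l4 := S4.le_i
  refine ⟨hle, ?_, ?_, ?_⟩
  · intro k hk
    by_cases hki : k = i
    · subst hki
      omega
    · obtain ⟨b1, b2⟩ := hb k (hlp k hk hki)
      refine ⟨S4.rmin_le k hki ?_, (hle k hki).trans b2⟩
      rw [xo3 k hki]
      refine S2.rmin_le k hki ?_
      rwa [xo1 k hki]
  · intro a ha hlt
    by_cases h2a : ν₂.x a < ν₁.x a
    · obtain ⟨g1, g2⟩ := S2.lt a ha h2a
      have hav := S2.av
      have hav4 := S4.av
      have hac : a ∈ candidates L i (.left i) := by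
        by_contra hac
        have := S2.eq a ha hac
        omega
      refine ⟨(c2 a).1 hac, by omega, fun l hl hl' hr => ?_⟩
      by_cases hli : l = i
      · subst hli
        -- The case l = i: AVAIL was exhausted by the first loop, so i can exceed its minimum only
        -- by taking from some k that ends after i. This k still had a surplus after the first loop,
        -- so it ends no later than a, and neither does i.
        obtain ⟨k, hk, hk'⟩ := S4.inc (by omega)
        have hk := (c4 k).1 hk
        have hkl : k ≠ l := by rintro rfl; omega
        have := S4.rmin_le k hkl
        have e3 := xo3 k hkl
        have hbk := hb k hk.1
        have r2 := S2.rmin_le k hkl (by rw [xo1 k hkl]; exact hbk.1)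
        have := g2 k ((c2 k).2 ⟨hk.1, by omega⟩) (by omega)
        omega
      · exact g2 l ((c2 l).2 ⟨hlp l hl hli, hl'⟩)
          (by have := le43 l hli; have := xo3 l hli; omega)
    · have e1 := xo1 a ha
      have e3 := xo3 a ha
      have e2 := le21 a ha
      obtain ⟨g1, g2⟩ := S4.lt a ha (by omega)
      have hac : a ∈ candidates L i (.right i) := by
        by_contra hac
        have := S4.eq a ha hac
        omega
      have hac' := (c4 a).1 hac
      have hav4 := S4.av
      refine ⟨⟨hac'.1, by omega⟩, by omega, fun l hl hl' hr => ?_⟩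
      -- The second loop only ranks jobs that end after i. Those that end no later than i, including
      -- i itself, end before a, since a was a candidate.
      by_cases hli : rpos L l ≤ rpos L i
      · omega
      · refine g2 l ((c4 l).2 ⟨hlp l hl ?_, by omega⟩) hr
        rintro rfl; omega
  · intro hlt
    have hav4 := S4.av
    refine ⟨by omega, fun l hl hl' hr => ?_⟩
    by_contra hli
    have := S4.done hlt l ((c4 l).2 ⟨hlp l hl (by rintro rfl; omega), by omega⟩)
    omega

/-- The jobs containing t hold pairwise disjoint subsets of {1, …, W}. This works at every stage and
for every t, past or future; the exchange argument applies it to times before the current endpoint.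
-/
theorem Tracks.cap {q : ℕ} {σ : FBAState n} {ν : NumState n} (h : I.Tracks L q σ ν)
    (hL : I.IsScanOrder L) (t : ℝ) :
    ∑ k, (Set.Ico (I.s k) (I.e k)).indicator (fun _ => ν.x k) t ≤ I.W := by
  classical
  have e : ∑ k, (Set.Ico (I.s k) (I.e k)).indicator (fun _ => ν.x k) t =
      ∑ k with t ∈ Set.Ico (I.s k) (I.e k), (σ.A k).card := by
    rw [Finset.sum_filter]
    refine Finset.sum_congr rfl fun k _ => ?_
    rw [Set.indicator_apply, h.card_A]
  rw [e, ← Finset.card_biUnion]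
  · refine (Finset.card_le_card (Finset.biUnion_subset.2 fun k _ => h.A_sub k)).trans ?_
    simp
  · intro a ha b hb hab
    simp only [Finset.coe_filter, Finset.mem_univ, true_and, Set.mem_ofPred_eq, Set.mem_Ico] at ha hb
    exact h.disj a b hab (hL.lpos_lt_rpos_iff.2 (ha.1.trans_lt hb.2))
      (hL.lpos_lt_rpos_iff.2 (hb.1.trans_lt ha.2))

/-! ### The exchange argument -/

/-- Moving a unit of an allocation from `a` to `l` does no harm if `l` ends first and
the part before the point `t₀` is under control. -/
theorem IsAllocation.exchange {y : Fin n → ℕ} (hy : I.IsAllocation y) {a l : Fin n} (hal : a ≠ l)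
    (hya : I.rmin a < y a) (hyl : y l < I.rmax l) {t₀ : ℝ} (hsa : I.s a ≤ t₀)
    (he : I.e l ≤ I.e a)
    (hbefore : ∀ t < t₀, ∑ k, (Set.Ico (I.s k) (I.e k)).indicator
      (fun _ => Function.update (Function.update y a (y a - 1)) l (y l + 1) k) t ≤ I.W) :
    I.IsAllocation (Function.update (Function.update y a (y a - 1)) l (y l + 1)) := by
  classical
  refine ⟨fun k => ?_, fun t => ?_⟩
  · have := hy.1 k
    simp only [Function.update_apply]
    split_ifs with h1 h2
    · subst h1; omega
    · subst h2; omega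
    · exact this
  · rcases lt_or_ge t t₀ with ht | ht
    · exact hbefore t ht
    refine le_trans ?_ (hy.2 t)
    have hsplit : ∀ z : Fin n → ℕ, ∑ k, (Set.Ico (I.s k) (I.e k)).indicator (fun _ => z k) t =
        (Set.Ico (I.s l) (I.e l)).indicator (fun _ => z l) t +
        ((Set.Ico (I.s a) (I.e a)).indicator (fun _ => z a) t +
          ∑ k ∈ (Finset.univ.erase l).erase a,
            (Set.Ico (I.s k) (I.e k)).indicator (fun _ => z k) t) := by
      intro z
      rw [← Finset.add_sum_erase Finset.univ _ (Finset.mem_univ l),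
        ← Finset.add_sum_erase (Finset.univ.erase l) _ (show a ∈ _ by simp [hal])]
    rw [hsplit, hsplit y, Function.update_self, Function.update_of_ne hal, Function.update_self]
    have hrest : ∑ k ∈ (Finset.univ.erase l).erase a, (Set.Ico (I.s k) (I.e k)).indicator
        (fun _ => Function.update (Function.update y a (y a - 1)) l (y l + 1) k) t =
        ∑ k ∈ (Finset.univ.erase l).erase a,
          (Set.Ico (I.s k) (I.e k)).indicator (fun _ => y k) t := by
      refine Finset.sum_congr rfl fun k hk => ?_
      simp only [Finset.mem_erase, Finset.mem_univ, and_true] at hk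
      rw [Function.update_of_ne hk.2, Function.update_of_ne hk.1]
    rw [hrest, ← add_assoc, ← add_assoc]
    refine Nat.add_le_add_right ?_ _
    simp only [Set.indicator_apply, Set.mem_Ico]
    -- After `t₀`, whenever l is active so is a, because `e l ≤ e a`; the unit gained by l is the
    -- one given up by a.
    by_cases hl : I.s l ≤ t ∧ t < I.e l
    · rw [if_pos hl, if_pos hl, if_pos ⟨hsa.trans ht, hl.2.trans_le he⟩,
        if_pos ⟨hsa.trans ht, hl.2.trans_le he⟩]
      omega
    · rw [if_neg hl, if_neg hl]
      split_ifs <;> omega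

theorem sum_exchange (y : Fin n → ℕ) {a l : Fin n} (hal : a ≠ l) (hya : 0 < y a) :
    ∑ k, Function.update (Function.update y a (y a - 1)) l (y l + 1) k = ∑ k, y k := by
  have hsplit : ∀ z : Fin n → ℕ, ∑ k, z k =
      z l + (z a + ∑ k ∈ (Finset.univ.erase l).erase a, z k) := by
    intro z
    rw [← Finset.add_sum_erase Finset.univ _ (Finset.mem_univ l),
        ← Finset.add_sum_erase (Finset.univ.erase l) _ (show a ∈ _ by simp [hal])]
  rw [hsplit, hsplit y, Function.update_self, Function.update_of_ne hal, Function.update_self]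
  have hrest : ∑ k ∈ (Finset.univ.erase l).erase a,
      Function.update (Function.update y a (y a - 1)) l (y l + 1) k =
      ∑ k ∈ (Finset.univ.erase l).erase a, y k := by
    refine Finset.sum_congr rfl fun k hk => ?_
    simp only [Finset.mem_erase, Finset.mem_univ, and_true] at hk
    rw [Function.update_of_ne hk.2, Function.update_of_ne hk.1]
  omega

/-- Every allocation can be turned into one of the same total that gives the jobs scanned so far
at most what the algorithm gives them. -/
def Dominates (I : FBAP n) (L : List (Endpoint n)) (q : ℕ) (ν : NumState n) : Prop :=
  ∀ y₀, I.IsAllocation y₀ → ∃ y, I.IsAllocation y ∧ ∑ k, y₀ k = ∑ k, y k ∧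
    ∀ k, lpos L k < q → y k ≤ ν.x k

theorem LeftSpec.dominates {i : Fin n} {σ σ' : FBAState n} {ν ν' : NumState n}
    (hS : LeftSpec I L i ν ν') (hL : I.IsScanOrder L) (h : I.Tracks L (lpos L i) σ ν)
    (h' : I.Tracks L (lpos L i + 1) σ' ν') (hD : Dominates I L (lpos L i) ν) :
    Dominates I L (lpos L i + 1) ν' := by
  classical
  intro y₀ hy₀
  obtain ⟨y, hy, hsum, hyx⟩ := hD y₀ hy₀
  -- The truncated differences measure by how much y exceeds the new counts. An exchange lowers the
  -- term of a by one and leaves that of l at zero, since y is strictly below the count there.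
  obtain ⟨d, hd⟩ : ∃ d, d = ∑ k with lpos L k ≤ lpos L i, (y k - ν'.x k) := ⟨_, rfl⟩
  induction d using Nat.strong_induction_on generalizing y with
  | _ d ih =>
  by_cases hdom : ∀ k, lpos L k < lpos L i + 1 → y k ≤ ν'.x k
  · exact ⟨y, hy, hsum, hdom⟩
  push Not at hdom
  obtain ⟨a, haq, hya⟩ := hdom
  have hi := hL.lpos_lt_rpos i
  have hlp : ∀ k, lpos L k ≤ lpos L i → k ≠ i → lpos L k < lpos L i := fun k hk hki =>
    lt_of_le_of_ne hk (fun h => hki (hL.lpos_inj.1 h))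
  have hba := hS.bounds a (by omega)
  obtain ⟨hact, hav, hfar⟩ : (lpos L a ≤ lpos L i ∧ lpos L i < rpos L a) ∧ ν'.av = 0 ∧
      ∀ l, lpos L l ≤ lpos L i → lpos L i < rpos L l → I.rmin l < ν'.x l →
        rpos L l ≤ rpos L a := by
    by_cases hai : a = i
    · subst hai
      obtain ⟨h1, h2⟩ := hS.lt_rmax (hya.trans_le (hy.1 a).2)
      exact ⟨⟨le_rfl, hi⟩, h1, h2⟩
    · obtain ⟨h1, h2, h3⟩ := hS.lt a hai (hya.trans_le (hyx a (hlp a (by omega) hai)))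
      exact ⟨⟨h1.1.le, h1.2⟩, h2, h3⟩
  have htot := h'.sum_active (i := i) rfl
  rw [hav, zero_add] at htot
  -- With AVAIL empty, the active counts add up to exactly W. If y were nowhere below them, its
  -- excess at a would push it over W at `s i`.
  obtain ⟨l, hl, hyl⟩ : ∃ l ∈ Finset.univ.filter
      (fun k => lpos L k ≤ lpos L i ∧ lpos L i < rpos L k), y l < ν'.x l := by
    by_contra hcon
    push Not at hcon
    have : ∑ k with lpos L k ≤ lpos L i ∧ lpos L i < rpos L k, ν'.x k <
        ∑ k with lpos L k ≤ lpos L i ∧ lpos L i < rpos L k, y k :=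
      Finset.sum_lt_sum hcon ⟨a, by simpa using hact, hya⟩
    have := hy.sum_active_le hL i
    omega
  simp only [Finset.mem_filter, Finset.mem_univ, true_and] at hl
  have hal : a ≠ l := by rintro rfl; omega
  have hbl := hS.bounds l hl.1
  have hyx' : ∀ k, lpos L k < lpos L i →
      Function.update (Function.update y a (y a - 1)) l (y l + 1) k ≤ ν.x k := by
    intro k hk
    have hk1 := hS.le k (by rintro rfl; omega)
    have hk2 := hyx k hk
    simp only [Function.update_apply]
    split_ifs with g1 g2
    · subst g1; omega
    · subst g2; omega
    · exact hk2
  refine ih _ ?_ (Function.update (Function.update y a (y a - 1)) l (y l + 1)) ?_ ?_ hyx' rfl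
  · rw [hd]
    refine Finset.sum_lt_sum (fun k _ => ?_) ⟨a, by simpa using hact.1, ?_⟩
    · simp only [Function.update_apply]
      split_ifs with g1 g2
      · subst g1; omega
      · subst g2; omega
      · exact le_rfl
    · rw [Function.update_of_ne hal, Function.update_self]
      omega
  · refine hy.exchange hal (by omega) (by omega) (hL.s_le_s hact.1)
      (hL.e_le_e (hfar l hl.1 hl.2 (lt_of_le_of_lt (hy.1 l).1 hyl))) fun t ht => ?_
    -- Before `s i` only earlier scanned jobs are active. On these the modified y is still below the
    -- old counts: if l is one of them, its new count exceeds y and is at most the old one.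
    refine le_trans (Finset.sum_le_sum fun k _ => ?_) (h.cap hL t)
    simp only [Set.indicator_apply, Set.mem_Ico]
    split_ifs with hk
    · exact hyx' k (hL.lpos_lt_of_s_lt (hk.1.trans_lt ht))
    · exact le_rfl
  · rw [sum_exchange y hal (by omega), hsum]

/-- All the work is at left endpoints; a right endpoint changes only AVAIL and adds no job to those
scanned. -/
theorem exec_spec {pick : Finset ℕ → ℕ → Finset ℕ} (hp : IsPick pick) (hL : I.IsScanOrder L)
    (hI : I.Feasible) (L' : List (Endpoint n)) (hpre : L' <+: L) :
    (∀ k, lpos L k < L'.length → I.rmin k ≤ (I.exec (I.allOps L L')).x k ∧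
      (I.exec (I.allOps L L')).x k ≤ I.rmax k) ∧
    Dominates I L L'.length (I.exec (I.allOps L L')) := by
  induction L' using List.reverseRecOn with
  | nil => exact ⟨fun k hk => absurd hk (Nat.not_lt_zero _),
      fun y hy => ⟨y, hy, rfl, fun k hk => absurd hk (Nat.not_lt_zero _)⟩⟩
  | append_singleton L' ep ih =>
    have hpre' := (List.prefix_append L' [ep]).trans hpre
    obtain ⟨hb, hD⟩ := ih hpre'
    have hidx := hL.idxOf_of_prefix hpre
    have hT := (foldl_scan hp hL L' hpre').2
    have hT' := (foldl_scan hp hL _ hpre).2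
    rw [allOps_append, exec_append] at hT' ⊢
    generalize I.exec (I.allOps L L') = ν at *
    rw [List.length_append, List.length_singleton] at *
    cases ep with
    | left i =>
      have hidx : lpos L i = L'.length := hidx
      generalize L'.length = q at *
      subst hidx
      have hS := hT.leftSpec hp hL hI i rfl hb
      exact ⟨fun k hk => hS.bounds k (by omega), hS.dominates hL hT hT' hD⟩
    | right i =>
      have hne : ∀ k, lpos L k < L'.length + 1 → lpos L k < L'.length := by
        intro k hk
        have := hL.lpos_ne_rpos k i
        have hidx : rpos L i = L'.length := hidx
        omega
      exact ⟨fun k hk => hb k (hne k hk), fun y hy => by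
        obtain ⟨z, h1, h2, h3⟩ := hD y hy
        exact ⟨z, h1, h2, fun k hk => h3 k (hne k hk)⟩⟩

theorem pagingFBA_card {pick : Finset ℕ → ℕ → Finset ℕ} (hp : IsPick pick)
    (hL : I.IsScanOrder L) (k : Fin n) :
    (I.pagingFBA pick L k).card = (I.exec (I.allOps L L)).x k :=
  (foldl_scan hp hL L List.prefix_rfl).2.card_A k

theorem pagingFBA_isColoring {pick : Finset ℕ → ℕ → Finset ℕ} (hp : IsPick pick)
    (hL : I.IsScanOrder L) : I.IsColoring (I.pagingFBA pick L) := by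
  have hT := (foldl_scan hp hL L List.prefix_rfl).2
  refine ⟨hT.A_sub, fun i j hij hd => ?_⟩
  obtain ⟨t, hi, hj⟩ := Set.not_disjoint_iff.1 hd
  exact hT.disj i j hij (hL.lpos_lt_rpos_iff.2 (hi.1.trans_lt hj.2))
    (hL.lpos_lt_rpos_iff.2 (hj.1.trans_lt hi.2))

theorem pagingFBA_isOptimal {pick : Finset ℕ → ℕ → Finset ℕ} (hp : IsPick pick)
    (hL : I.IsScanOrder L) (hI : I.Feasible) (h1 : ∀ i, I.p i = 1) :
    I.IsOptimal (fun i => (I.pagingFBA pick L i).card) := by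
  have hT := (foldl_scan hp hL L List.prefix_rfl).2
  obtain ⟨hb, hD⟩ := exec_spec hp hL hI L List.prefix_rfl
  simp only [pagingFBA_card hp hL]
  have hlt : ∀ k, lpos L k < L.length := fun k => hL.idxOf_lt _
  refine ⟨⟨fun k => hb k (hlt k), fun t => hT.cap hL t⟩, fun y hy => ?_⟩
  obtain ⟨z, -, h2, h3⟩ := hD y hy
  simp only [profit, h1, one_mul]
  rw [← Nat.cast_sum, ← Nat.cast_sum, h2]
  exact_mod_cast Finset.sum_le_sum fun k _ => h3 k (hlt k)

end FBAP

/-! ### Program logic with a credit of steps -/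

namespace RAM

/-- The program is a sequence of assignments and case distinctions. -/
def Prog.loopFree : Prog → Bool
  | .skip => true
  | .set _ _ => true
  | .put _ _ _ => true
  | .seq P Q => P.loopFree && Q.loopFree
  | .ite _ P Q => P.loopFree && Q.loopFree
  | .loop _ _ => false

/-- A bound on the running time of a loop-free program. -/
def Prog.cost : Prog → ℕ
  | .skip => 1
  | .set _ u => u.cost + 1
  | .put _ i u => i.cost + u.cost + 1
  | .seq P Q => P.cost + Q.cost
  | .ite b P Q => b.cost + 1 + (P.cost + Q.cost)
  | .loop _ _ => 0

open Classical in
/-- The effect of a loop-free program on the memory. -/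
noncomputable def Prog.run (key : ℕ → ℝ) : Prog → Mem → Mem
  | .skip, μ => μ
  | .set x u, μ => { μ with reg := Function.update μ.reg x (u.val μ) }
  | .put a i u, μ =>
      { μ with arr := Function.update μ.arr a (Function.update (μ.arr a) (i.val μ) (u.val μ)) }
  | .seq P Q, μ => Q.run key (P.run key μ)
  | .ite b P Q, μ => if b.Holds key μ then P.run key μ else Q.run key μ
  | .loop _ _, μ => μ

theorem Prog.run_ite_pos {key : ℕ → ℝ} {b : Test} {P Q : Prog} {μ : Mem} (h : b.Holds key μ) :
    (Prog.ite b P Q).run key μ = P.run key μ := if_pos h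

theorem Prog.run_ite_neg {key : ℕ → ℝ} {b : Test} {P Q : Prog} {μ : Mem}
    (h : ¬ b.Holds key μ) : (Prog.ite b P Q).run key μ = Q.run key μ := if_neg h

theorem exec_of_loopFree (key : ℕ → ℝ) (P : Prog) (hP : P.loopFree = true) (μ : Mem) :
    ∃ t ≤ P.cost, Exec key P μ t (P.run key μ) := by
  induction P generalizing μ with
  | skip => exact ⟨1, le_rfl, .skip μ⟩
  | set x u => exact ⟨_, le_rfl, .set x u μ⟩
  | put a i u => exact ⟨_, le_rfl, .put a i u μ⟩
  | seq P Q ihP ihQ =>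
    simp only [Prog.loopFree, Bool.and_eq_true] at hP
    obtain ⟨t₁, h₁, e₁⟩ := ihP hP.1 μ
    obtain ⟨t₂, h₂, e₂⟩ := ihQ hP.2 (P.run key μ)
    exact ⟨_, Nat.add_le_add h₁ h₂, .seq e₁ e₂⟩
  | ite b P Q ihP ihQ =>
    simp only [Prog.loopFree, Bool.and_eq_true] at hP
    by_cases hb : b.Holds key μ
    · obtain ⟨t₁, h₁, e₁⟩ := ihP hP.1 μ
      refine ⟨b.cost + 1 + t₁, by simp only [Prog.cost]; omega, ?_⟩
      simpa only [Prog.run, if_pos hb] using .iteTrue hb e₁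
    · obtain ⟨t₁, h₁, e₁⟩ := ihQ hP.2 μ
      refine ⟨b.cost + 1 + t₁, by simp only [Prog.cost]; omega, ?_⟩
      simpa only [Prog.run, if_neg hb] using .iteFalse hb e₁
  | loop b P => simp [Prog.loopFree] at hP

/-- Started with memory `μ` and a credit of `B` steps, `P` halts with a memory and a remaining
credit that satisfy `Q`. -/
def Runs (key : ℕ → ℝ) (P : Prog) (μ : Mem) (B : ℕ) (Q : ℕ → Mem → Prop) : Prop :=
  ∃ t μ' B', Exec key P μ t μ' ∧ t + B' ≤ B ∧ Q B' μ'

namespace Runs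

variable {key : ℕ → ℝ} {P P' : Prog} {b : Test} {μ : Mem} {B : ℕ} {Q Q' : ℕ → Mem → Prop}

theorem mono (h : Runs key P μ B Q) (hQ : ∀ B μ, Q B μ → ∃ B' ≤ B, Q' B' μ) :
    Runs key P μ B Q' := by
  obtain ⟨t, μ', B', h1, h2, h3⟩ := h
  obtain ⟨B'', h4, h5⟩ := hQ _ _ h3
  exact ⟨t, μ', B'', h1, by omega, h5⟩

theorem of_loopFree (hP : P.loopFree = true) (B' : ℕ) (hB : P.cost + B' ≤ B)
    (hQ : Q B' (P.run key μ)) : Runs key P μ B Q := by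
  obtain ⟨t, h1, h2⟩ := exec_of_loopFree key P hP μ
  exact ⟨t, _, B', h2, by omega, hQ⟩

theorem seq (h : Runs key P μ B (fun B' μ' => Runs key P' μ' B' Q)) :
    Runs key (.seq P P') μ B Q := by
  obtain ⟨t, μ', B', h1, h2, t', μ'', B'', h3, h4, h5⟩ := h
  exact ⟨t + t', μ'', B'', .seq h1 h3, by omega, h5⟩

theorem ite (B' : ℕ) (hB : b.cost + 1 + B' ≤ B) (h1 : b.Holds key μ → Runs key P μ B' Q)
    (h2 : ¬ b.Holds key μ → Runs key P' μ B' Q) : Runs key (.ite b P P') μ B Q := by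
  by_cases hb : b.Holds key μ
  · obtain ⟨t, μ', B'', h1, h2, h3⟩ := h1 hb
    exact ⟨_, μ', B'', .iteTrue hb h1, by omega, h3⟩
  · obtain ⟨t, μ', B'', h1, h2, h3⟩ := h2 hb
    exact ⟨_, μ', B'', .iteFalse hb h1, by omega, h3⟩

/-- Termination needs no separate variant: each evaluation of the test consumes credit. The
invariant may mention the credit, which permits amortized bounds. -/
theorem loop (Inv : ℕ → Mem → Prop) (hcost : ∀ B μ, Inv B μ → b.cost + 1 ≤ B)
    (hbody : ∀ B μ, Inv B μ → b.Holds key μ → Runs key P μ (B - (b.cost + 1)) Inv)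
    (hend : ∀ B μ, Inv B μ → ¬ b.Holds key μ → Q (B - (b.cost + 1)) μ)
    (hInv : Inv B μ) : Runs key (.loop b P) μ B Q := by
  induction B using Nat.strong_induction_on generalizing μ with
  | _ B ih =>
  have hc := hcost B μ hInv
  by_cases hb : b.Holds key μ
  · obtain ⟨t, μ', B', h1, h2, h3⟩ := hbody B μ hInv hb
    obtain ⟨t', μ'', B'', h4, h5, h6⟩ := ih B' (by omega) h3
    exact ⟨_, μ'', B'', .loopTrue hb h1 h4, by omega, h6⟩
  · exact ⟨_, μ, B - (b.cost + 1), .loopFalse hb, by omega, hend B μ hInv hb⟩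

end Runs

/-! ### Tournament trees -/

open Classical in
/-- The winner of two entries: `y` if it beats `x`. -/
noncomputable def winner (C : ℕ → ℕ → Prop) (x y : ℕ) : ℕ := if C x y then y else x

/-- In the array `T` with leaves `N, …, 2 * N - 1` every inner node holds the winner of its
children. -/
def IsTournament (C : ℕ → ℕ → Prop) (N : ℕ) (T : ℕ → ℕ) : Prop :=
  ∀ v, 1 ≤ v → v < N → T v = winner C (T (2 * v)) (T (2 * v + 1))

theorem IsTournament.exists_leaf {C : ℕ → ℕ → Prop} {N : ℕ} {T : ℕ → ℕ}
    (h : IsTournament C N T) (v : ℕ) (hv : 1 ≤ v) (hv' : v < 2 * N) :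
    ∃ j < N, T (N + j) = T v := by
  by_cases hvN : N ≤ v
  · exact ⟨v - N, by omega, by congr 1; omega⟩
  · have e := h v hv (by omega)
    unfold winner at e
    split_ifs at e with hC
    · obtain ⟨j, hj, hj'⟩ := h.exists_leaf (2 * v + 1) (by omega) (by omega)
      exact ⟨j, hj, hj'.trans e.symm⟩
    · obtain ⟨j, hj, hj'⟩ := h.exists_leaf (2 * v) (by omega) (by omega)
      exact ⟨j, hj, hj'.trans e.symm⟩
termination_by 2 * N - v

/-- Climb from v to the root, where each parent is at least as good as its children. The preorder is
left abstract because one tree looks for the first endpoint and the other for the largest place. The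
number of leaves need not be a power of two. -/
theorem IsTournament.root_le {C le : ℕ → ℕ → Prop} {N : ℕ} {T : ℕ → ℕ}
    (h : IsTournament C N T) (hrefl : ∀ x, le x x)
    (htrans : ∀ x y z, le x y → le y z → le x z)
    (h1 : ∀ x y, C x y → le y x) (h2 : ∀ x y, ¬ C x y → le x y)
    (v : ℕ) (hv : 1 ≤ v) (hv' : v < 2 * N) : le (T 1) (T v) := by
  induction v using Nat.strong_induction_on with
  | _ v ih =>
  by_cases hv1 : v = 1
  · subst hv1; exact hrefl _
  · refine htrans _ _ _ (ih (v / 2) (by omega) (by omega) (by omega)) ?_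
    rw [h (v / 2) (by omega) (by omega)]
    unfold winner
    rcases Nat.mod_two_eq_zero_or_one v with hm | hm
    · have : v = 2 * (v / 2) := by omega
      split_ifs with hC
      · rw [this.symm] at hC ⊢; exact h1 _ _ hC
      · rw [this.symm]; exact hrefl _
    · have : 2 * (v / 2) + 1 = v := by omega
      split_ifs with hC
      · rw [this]; exact hrefl _
      · rw [this] at hC; exact h2 _ _ hC

/-- Restore the tournament in array `a` after a change at the leaf in register `4`. The test
`c` compares the entries in registers `5` and `6`. -/
def fixUp (a : ℕ) (c : Test) : Prog :=
  .seq (.set 4 (.half (.reg 4)))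
    (.loop (.lt (.lit 0) (.reg 4))
      (.seq (.seq (.set 5 (.get a (.add (.reg 4) (.reg 4))))
          (.set 6 (.get a (.add (.add (.reg 4) (.reg 4)) (.lit 1)))))
        (.seq (.ite c (.put a (.reg 4) (.reg 6)) (.put a (.reg 4) (.reg 5)))
          (.set 4 (.half (.reg 4))))))

/-- The memories differ at most in array `a` and in registers `4`, `5`, `6`. -/
structure SameBut (a : ℕ) (μ μ' : Mem) : Prop where
  reg : ∀ x, x ≠ 4 → x ≠ 5 → x ≠ 6 → μ'.reg x = μ.reg x
  arr : ∀ b, b ≠ a → μ'.arr b = μ.arr b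

/-- Only ancestors of the changed leaf can be wrong, and repairing one leaves at most its parent
wrong. Halving the node index reaches 0 after at most `d + 1` halvings; 100 steps pay for a level,
the comparison taking at most 60 of them. -/
theorem runs_fixUp {key : ℕ → ℝ} {a n : ℕ} {c : Test} {C : ℕ → ℕ → Prop} (hcc : c.cost ≤ 60)
    (hc : ∀ μ : Mem, μ.reg 0 = n → (c.Holds key μ ↔ C (μ.reg 5) (μ.reg 6)))
    {N d : ℕ} {μ : Mem} (h0 : μ.reg 0 = n) (hd : μ.reg 4 < 2 ^ (d + 1)) (hw : μ.reg 4 < 2 * N)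
    (hT : ∀ v, 1 ≤ v → v < N → v ≠ μ.reg 4 / 2 →
      μ.arr a v = winner C (μ.arr a (2 * v)) (μ.arr a (2 * v + 1)))
    {B : ℕ} {Q : ℕ → Mem → Prop}
    (hQ : ∀ μ', SameBut a μ μ' → IsTournament C N (μ'.arr a) →
      (∀ u, N ≤ u → μ'.arr a u = μ.arr a u) → Q B μ') :
    Runs key (fixUp a c) μ (100 * (d + 1) + B) Q := by
  refine .seq (.of_loopFree rfl (4 + 100 * d + B) (by simp [Prog.cost, Exp.cost]; omega) ?_)
  let Inv : ℕ → Mem → Prop := fun B' ν => ∃ d', SameBut a μ ν ∧ ν.reg 4 < 2 ^ d' ∧ ν.reg 4 < N ∧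
    (∀ v, 1 ≤ v → v < N → v ≠ ν.reg 4 →
      ν.arr a v = winner C (ν.arr a (2 * v)) (ν.arr a (2 * v + 1))) ∧
    (∀ u, N ≤ u → ν.arr a u = μ.arr a u) ∧ B' = 4 + 100 * d' + B
  have hcost : (Test.lt (.lit 0) (.reg 4)).cost = 3 := rfl
  refine .mono (Q := fun B' ν => ∃ B'', B ≤ B' ∧ Inv B'' ν ∧ ν.reg 4 = 0) ?_ ?_
  · refine .loop Inv ?_ ?_ ?_ ?_
    · rintro B' ν ⟨d', -, -, -, -, -, h⟩
      rw [hcost]; omega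
    · rintro B' ν ⟨d', hs, h1, h2, h3, h4, rfl⟩ hb
      simp only [Test.Holds, Exp.val] at hb
      obtain ⟨d, rfl⟩ : ∃ e, d' = e + 1 := by
        cases d' with
        | zero => simp at h1; omega
        | succ e => exact ⟨e, rfl⟩
      have hν0 : ν.reg 0 = n := by rw [hs.reg 0 (by omega) (by omega) (by omega), h0]
      rw [pow_succ] at h1
      refine .of_loopFree rfl (4 + 100 * d + B) (by simp [Prog.cost, Exp.cost, hcost]; omega) ?_
      obtain ⟨ν₂, hν₂⟩ : ∃ ν₂ : Mem, ν₂ = ⟨Function.update (Function.update ν.reg 5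
        (ν.arr a (2 * ν.reg 4))) 6 (ν.arr a (2 * ν.reg 4 + 1)), ν.arr⟩ := ⟨_, rfl⟩
      have hval := hc ν₂ (by simpa [hν₂] using hν0)
      have hrun₁ : Prog.run key (.seq (.set 5 (.get a (.add (.reg 4) (.reg 4))))
          (.set 6 (.get a (.add (.add (.reg 4) (.reg 4)) (.lit 1))))) ν = ν₂ := by
        simp [Prog.run, Exp.val, hν₂, two_mul]
      have hrun : Prog.run key (.seq (.seq (.set 5 (.get a (.add (.reg 4) (.reg 4))))
          (.set 6 (.get a (.add (.add (.reg 4) (.reg 4)) (.lit 1)))))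
        (.seq (.ite c (.put a (.reg 4) (.reg 6)) (.put a (.reg 4) (.reg 5)))
          (.set 4 (.half (.reg 4))))) ν =
          { reg := Function.update ν₂.reg 4 (ν.reg 4 / 2)
            arr := Function.update ν.arr a (Function.update (ν.arr a) (ν.reg 4)
              (winner C (ν.arr a (2 * ν.reg 4)) (ν.arr a (2 * ν.reg 4 + 1)))) } := by
        rw [Prog.run, hrun₁, Prog.run, winner]
        have e5 : ν₂.reg 5 = ν.arr a (2 * ν.reg 4) := by simp [hν₂]
        have e6 : ν₂.reg 6 = ν.arr a (2 * ν.reg 4 + 1) := by simp [hν₂]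
        have e4 : ν₂.reg 4 = ν.reg 4 := by simp [hν₂]
        have ea : ν₂.arr = ν.arr := by simp [hν₂]
        rw [e5, e6] at hval
        by_cases hC : C (ν.arr a (2 * ν.reg 4)) (ν.arr a (2 * ν.reg 4 + 1))
        · rw [if_pos hC, Prog.run_ite_pos (hval.2 hC)]
          simp [Prog.run, Exp.val, e4, e6, ea]
        · rw [if_neg hC, Prog.run_ite_neg (fun h => hC (hval.1 h))]
          simp [Prog.run, Exp.val, e4, e5, ea]
      rw [hrun]
      refine ⟨d, ⟨fun x g1 g2 g3 => ?_, fun b g => ?_⟩, ?_, ?_, ?_, ?_, rfl⟩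
      · simp [hν₂, g1, g2, g3, hs.reg x g1 g2 g3]
      · simp [g, hs.arr b g]
      · simp; omega
      · simp; omega
      · intro v g1 g2 g3
        simp only [Function.update_self, Function.update_apply] at g3 ⊢
        rw [if_neg (show ¬ 2 * v = ν.reg 4 by omega),
          if_neg (show ¬ 2 * v + 1 = ν.reg 4 by omega)]
        split_ifs with g4
        · rw [g4]
        · exact h3 v g1 g2 g4
      · intro u hu
        simp only [Function.update_self, Function.update_apply]
        rw [if_neg (by omega)]
        exact h4 u hu
    · rintro B' ν ⟨d', hs, h1, h2, h3, h4, rfl⟩ hb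
      simp only [Test.Holds, Exp.val] at hb
      exact ⟨_, by rw [hcost]; omega, ⟨d', hs, h1, h2, h3, h4, rfl⟩, by omega⟩
    · refine ⟨d, ⟨fun x g1 g2 g3 => ?_, fun b g => ?_⟩, ?_, ?_, ?_, ?_, ?_⟩
      · simp [Prog.run, g1]
      · simp [Prog.run]
      · simp [Prog.run, Exp.val]; omega
      · simp [Prog.run, Exp.val]; omega
      · simpa [Prog.run, Exp.val] using hT
      · simp [Prog.run]
      · rfl
  · rintro B' ν ⟨B'', hB, ⟨d', hs, h1, h2, h3, h4, -⟩, h5⟩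
    exact ⟨B, hB, hQ ν hs (fun v g1 g2 => h3 v g1 g2 (by omega)) h4⟩

end RAM

namespace RAM

theorem winner_self (C : ℕ → ℕ → Prop) (x : ℕ) : winner C x x = x := by
  unfold winner
  split_ifs <;> rfl

/-- Store `u` at the leaf in register `4` and restore the tournament. -/
def setLeaf (a : ℕ) (c : Test) (u : Exp) : Prog := .seq (.put a (.reg 4) u) (fixUp a c)

theorem runs_setLeaf {key : ℕ → ℝ} {a n : ℕ} {c : Test} {C : ℕ → ℕ → Prop} (hcc : c.cost ≤ 60)
    (hc : ∀ μ : Mem, μ.reg 0 = n → (c.Holds key μ ↔ C (μ.reg 5) (μ.reg 6)))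
    {N d D q : ℕ} {u : Exp} {μ : Mem} (hD : D = 100 * (d + 1))
    (hu : u.cost ≤ 8) (h0 : μ.reg 0 = n) (hd : 2 * N ≤ 2 ^ (d + 1))
    (h4 : μ.reg 4 = N + q) (hq : q < N) (hT : IsTournament C N (μ.arr a))
    {B : ℕ} {Q : ℕ → Mem → Prop}
    (hQ : ∀ μ', SameBut a μ μ' → IsTournament C N (μ'.arr a) →
      (∀ q' < N, μ'.arr a (N + q') = if q' = q then u.val μ else μ.arr a (N + q')) → Q B μ') :
    Runs key (setLeaf a c u) μ (10 + D + B) Q := by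
  subst hD
  refine .seq (.of_loopFree rfl (100 * (d + 1) + B) (by simp [Prog.cost, Exp.cost]; omega) ?_)
  refine runs_fixUp hcc hc (N := N) ?_ ?_ ?_ ?_ ?_
  · simpa [Prog.run] using h0
  · simp [Prog.run]; omega
  · simp [Prog.run]; omega
  · intro v g1 g2 g3
    simp only [Prog.run, Exp.val, Function.update_self, Function.update_apply] at g3 ⊢
    rw [if_neg (by omega), if_neg (by omega), if_neg (by omega)]
    exact hT v g1 g2
  · intro μ' hs hT' hleaf
    refine hQ μ' ⟨fun x g1 g2 g3 => ?_, fun b g => ?_⟩ hT' fun q' hq' => ?_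
    · simpa [Prog.run] using hs.reg x g1 g2 g3
    · simpa [Prog.run, g] using hs.arr b g
    · rw [hleaf _ (by omega)]
      simp [Prog.run, Exp.val, Function.update_apply, h4]

end RAM

/-! ### Sorting the endpoints with a tournament -/

namespace FBAP

variable {n : ℕ}

/-- The endpoint with number `j` may be scanned before the one with number `k`. -/
def KeyLe (I : FBAP n) (j k : ℕ) : Prop :=
  I.key j < I.key k ∨ (I.key j = I.key k ∧ ¬ (j < n ∧ n ≤ k))

/-- The entry `y` of the tournament of the endpoints beats the entry `x`. -/
def KeyBeats (I : FBAP n) (x y : ℕ) : Prop := y ≠ 0 ∧ (x = 0 ∨ ¬ I.KeyLe (x - 1) (y - 1))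

theorem KeyLe.refl (I : FBAP n) (j : ℕ) : I.KeyLe j j := Or.inr ⟨rfl, by omega⟩

theorem KeyLe.trans {I : FBAP n} {j k l : ℕ} (h1 : I.KeyLe j k) (h2 : I.KeyLe k l) :
    I.KeyLe j l := by
  rcases h1 with h1 | ⟨h1, g1⟩ <;> rcases h2 with h2 | ⟨h2, g2⟩
  · exact Or.inl (h1.trans h2)
  · exact Or.inl (h2 ▸ h1)
  · exact Or.inl (h1 ▸ h2)
  · exact Or.inr ⟨h1.trans h2, by omega⟩

theorem KeyLe.of_not {I : FBAP n} {j k : ℕ} (h : ¬ I.KeyLe j k) : I.KeyLe k j := by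
  unfold KeyLe at *
  push Not at h
  rcases h.1.lt_or_eq with h' | h'
  · exact Or.inl h'
  · exact Or.inr ⟨h', by have := h.2 h'.symm; omega⟩

theorem KeyBeats.root_le {I : FBAP n} {N : ℕ} {T : ℕ → ℕ}
    (h : RAM.IsTournament I.KeyBeats N T) {q : ℕ} (hq : q < N) (hq0 : T (N + q) ≠ 0) :
    T 1 ≠ 0 ∧ I.KeyLe (T 1 - 1) (T (N + q) - 1) := by
  -- The entry 0 marks an empty leaf and j + 1 the endpoint j; this preorder puts empty leaves last.
  have := h.root_le (le := fun x y => y = 0 ∨ (x ≠ 0 ∧ I.KeyLe (x - 1) (y - 1)))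
    (fun x => by
      by_cases hx : x = 0
      · exact Or.inl hx
      · exact Or.inr ⟨hx, KeyLe.refl I _⟩)
    (fun x y z h1 h2 => by
      rcases h2 with h2 | h2
      · exact Or.inl h2
      · rcases h1 with h1 | h1
        · exact absurd h1 h2.1
        · exact Or.inr ⟨h1.1, h1.2.trans h2.2⟩)
    (fun x y hxy => by
      obtain ⟨hy, hxy | hxy⟩ := hxy
      · exact Or.inl hxy
      · exact Or.inr ⟨hy, KeyLe.of_not hxy⟩)
    (fun x y hxy => by
      unfold KeyBeats at hxy
      by_cases hy : y = 0
      · exact Or.inl hy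
      · refine Or.inr ⟨fun hx => hxy ⟨hy, Or.inl hx⟩, ?_⟩
        by_contra hc
        exact hxy ⟨hy, Or.inr hc⟩)
    (N + q) (by omega) (by omega)
  rcases this with h | h
  · exact absurd h hq0
  · exact h

open RAM

/-- The test for `KeyBeats`. -/
def keyTest : Test :=
  .and (.lt (.lit 0) (.reg 6))
    (.neg (.and (.lt (.lit 0) (.reg 5))
      (.and (.neg (.keyLt (.sub (.reg 6) (.lit 1)) (.sub (.reg 5) (.lit 1))))
        (.neg (.and (.neg (.keyLt (.sub (.reg 5) (.lit 1)) (.sub (.reg 6) (.lit 1))))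
          (.and (.lt (.sub (.reg 5) (.lit 1)) (.reg 0))
            (.neg (.lt (.sub (.reg 6) (.lit 1)) (.reg 0)))))))))

theorem keyTest_holds (I : FBAP n) (μ : Mem) (h0 : μ.reg 0 = n) :
    keyTest.Holds I.key μ ↔ I.KeyBeats (μ.reg 5) (μ.reg 6) := by
  simp only [keyTest, Test.Holds, Exp.val, KeyBeats, KeyLe, h0]
  generalize μ.reg 5 = x
  generalize μ.reg 6 = y
  generalize I.key (x - 1) = a
  generalize I.key (y - 1) = b
  rcases lt_trichotomy a b with h | h | h
  · simp [h, h.not_gt, Nat.pos_iff_ne_zero]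
  · simp [h, Nat.pos_iff_ne_zero]; tauto
  · simp [h, h.not_gt, h.ne', Nat.pos_iff_ne_zero]

/-- Enter all endpoints into the tournament. -/
def insertAll : Prog :=
  .seq (.set 7 (.lit 0)) (.loop (.lt (.reg 7) (.add (.reg 0) (.reg 0)))
    (.seq (.set 4 (.add (.add (.reg 0) (.reg 0)) (.reg 7)))
      (.seq (setLeaf 8 keyTest (.add (.reg 7) (.lit 1))) (.set 7 (.add (.reg 7) (.lit 1))))))

theorem runs_insertAll (I : FBAP n) {d : ℕ} (hd : 4 * n ≤ 2 ^ (d + 1)) {μ : Mem}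
    (h0 : μ.reg 0 = n) (h8 : ∀ v, μ.arr 8 v = 0) {B : ℕ} {Q : ℕ → Mem → Prop}
    (hQ : ∀ μ' : Mem, (∀ x < 4, μ'.reg x = μ.reg x) → (∀ a ≠ 8, μ'.arr a = μ.arr a) →
      IsTournament I.KeyBeats (2 * n) (μ'.arr 8) →
      (∀ q < 2 * n, μ'.arr 8 (2 * n + q) = q + 1) → Q B μ') :
    Runs I.key insertAll μ (10 + 2 * n * (100 * (d + 1) + 40) + B) Q := by
  -- Opaque names for the cost of one tree update and of one round keep the bookkeeping linear for
  -- `omega`.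
  obtain ⟨D, hD⟩ : ∃ D, D = 100 * (d + 1) := ⟨_, rfl⟩
  obtain ⟨E, hE⟩ : ∃ E, E = D + 40 := ⟨_, rfl⟩
  rw [← hD, ← hE]
  refine .seq (.of_loopFree rfl (8 + 2 * n * E + B) (by simp [Prog.cost, Exp.cost]; omega) ?_)
  have hcost : (Test.lt (.reg 7) (.add (.reg 0) (.reg 0))).cost = 5 := rfl
  refine .mono (Q := fun B' ν => B ≤ B' ∧ Q B ν) ?_ fun B' ν h => ⟨B, h⟩
  refine .loop (fun B' ν => ∃ p r, ν.reg 7 = p ∧ p + r = 2 * n ∧ B' = 8 + r * E + B ∧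
    (∀ x < 4, ν.reg x = μ.reg x) ∧ (∀ a ≠ 8, ν.arr a = μ.arr a) ∧
    IsTournament I.KeyBeats (2 * n) (ν.arr 8) ∧
    (∀ q < 2 * n, ν.arr 8 (2 * n + q) = if q < p then q + 1 else 0)) ?_ ?_ ?_ ?_
  · rintro B' ν ⟨p, r, -, -, rfl, -⟩
    rw [hcost]; omega
  · rintro B' ν ⟨p, r, h7, hr, rfl, hreg, harr, hT, hleaf⟩ hb
    simp only [Test.Holds, Exp.val] at hb
    have hν0 : ν.reg 0 = n := by rw [hreg 0 (by omega), h0]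
    obtain ⟨r, rfl⟩ : ∃ r', r = r' + 1 := ⟨r - 1, by omega⟩
    rw [Nat.succ_mul]
    refine .seq (.of_loopFree rfl (10 + D + (10 + (8 + r * E + B)))
      (by simp [Prog.cost, Exp.cost, hcost]; omega) ?_)
    refine .seq (runs_setLeaf (N := 2 * n) (n := n) (q := p) (by decide) (keyTest_holds I) hD
      (by decide) ?_ (by omega) ?_ (by omega) ?_ ?_)
    · simpa [Prog.run] using hν0
    · simp [Prog.run, Exp.val, hν0, h7]; omega
    · simpa [Prog.run] using hT
    · intro ν' hs hT' hleaf'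
      refine .of_loopFree rfl (8 + r * E + B) (by simp [Prog.cost, Exp.cost]) ?_
      have h7' : ν'.reg 7 = p := by
        rw [hs.reg 7 (by omega) (by omega) (by omega)]; simpa [Prog.run] using h7
      refine ⟨p + 1, r, ?_, by omega, rfl, fun x hx => ?_, fun a ha => ?_, ?_, fun q hq => ?_⟩
      · simp [Prog.run, Exp.val, h7']
      · by_cases hx4 : x = 4
        · omega
        · have := hs.reg x hx4 (by omega) (by omega)
          simp [Prog.run, hx4] at this
          simp [Prog.run, show x ≠ 7 by omega, this, hreg x hx]
      · have := hs.arr a ha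
        simp [Prog.run] at this
        simp [Prog.run, this, harr a ha]
      · simpa [Prog.run] using hT'
      · have := hleaf' q hq
        simp only [Prog.run, Exp.val] at this ⊢
        rw [this]
        simp only [ne_eq, Nat.reduceEqDiff, not_false_eq_true, Function.update_of_ne, h7]
        rw [hleaf q hq]
        split_ifs <;> omega
  · rintro B' ν ⟨p, r, h7, hr, rfl, hreg, harr, hT, hleaf⟩ hb
    simp only [Test.Holds, Exp.val] at hb
    have hν0 : ν.reg 0 = n := by rw [hreg 0 (by omega), h0]
    refine ⟨by rw [hcost]; omega, hQ ν hreg harr hT fun q hq => ?_⟩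
    rw [hleaf q hq, if_pos (by omega)]
  · refine ⟨0, 2 * n, by simp [Prog.run, Exp.val], by omega, by omega, fun x hx => ?_,
      fun a ha => rfl, fun v h1 h2 => ?_, fun q hq => ?_⟩
    · simp [Prog.run, show x ≠ 7 by omega]
    · change μ.arr 8 v = winner _ (μ.arr 8 (2 * v)) (μ.arr 8 (2 * v + 1))
      rw [h8, h8, h8, winner_self]
    · simp [Prog.run, h8]

/-- Extract all endpoints from the tournament, the best one first; array `6` gets the endpoints
and array `7` their places. -/
def extractAll : Prog :=
  .seq (.set 7 (.lit 0)) (.loop (.lt (.reg 7) (.add (.reg 0) (.reg 0)))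
    (.seq (.seq (.seq (.set 12 (.sub (.get 8 (.lit 1)) (.lit 1))) (.put 6 (.reg 7) (.reg 12)))
      (.seq (.put 7 (.reg 12) (.reg 7)) (.set 4 (.add (.add (.reg 0) (.reg 0)) (.reg 12)))))
      (.seq (setLeaf 8 keyTest (.lit 0)) (.set 7 (.add (.reg 7) (.lit 1))))))

/-- The first `p` entries of `ord` are the first `p` endpoints in a scan order. -/
structure SortedUpTo (I : FBAP n) (p : ℕ) (ord pos : ℕ → ℕ) : Prop where
  lt : ∀ a < p, ord a < 2 * n
  pos_ord : ∀ a < p, pos (ord a) = a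
  le : ∀ a < p, ∀ b < p, a < b → I.KeyLe (ord a) (ord b)

theorem exists_notMem_image {m p : ℕ} (ord : ℕ → ℕ) (hp : p < m) :
    ∃ j < m, ∀ a < p, ord a ≠ j := by
  have : ((Finset.range p).image ord).card < (Finset.range m).card :=
    Finset.card_image_le.trans_lt (by simpa using hp)
  obtain ⟨j, h1, h2⟩ := Finset.exists_mem_notMem_of_card_lt_card this
  refine ⟨j, by simpa using h1, fun a ha e => h2 ?_⟩
  exact Finset.mem_image.2 ⟨a, by simpa using ha, e⟩

/-- Selection sort with a fast minimum: extracted endpoints have empty leaves, and each of them may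
precede everything not yet extracted, so appending the next minimum keeps the list sorted. -/
theorem runs_extractAll (I : FBAP n) {d : ℕ} (hd : 4 * n ≤ 2 ^ (d + 1)) {μ : Mem}
    (h0 : μ.reg 0 = n) (hT : IsTournament I.KeyBeats (2 * n) (μ.arr 8))
    (hleaf : ∀ q < 2 * n, μ.arr 8 (2 * n + q) = q + 1) {B : ℕ} {Q : ℕ → Mem → Prop}
    (hQ : ∀ μ' : Mem, (∀ x < 4, μ'.reg x = μ.reg x) →
      (∀ a, a ≠ 6 → a ≠ 7 → a ≠ 8 → μ'.arr a = μ.arr a) →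
      SortedUpTo I (2 * n) (μ'.arr 6) (μ'.arr 7) → Q B μ') :
    Runs I.key extractAll μ (10 + 2 * n * (100 * (d + 1) + 50) + B) Q := by
  classical
  obtain ⟨D, hD⟩ : ∃ D, D = 100 * (d + 1) := ⟨_, rfl⟩
  obtain ⟨E, hE⟩ : ∃ E, E = D + 50 := ⟨_, rfl⟩
  rw [← hD, ← hE]
  refine .seq (.of_loopFree rfl (8 + 2 * n * E + B) (by simp [Prog.cost, Exp.cost]; omega) ?_)
  have hcost : (Test.lt (.reg 7) (.add (.reg 0) (.reg 0))).cost = 5 := rfl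
  refine .mono (Q := fun B' ν => B ≤ B' ∧ Q B ν) ?_ fun B' ν h => ⟨B, h⟩
  refine .loop (fun B' ν => ∃ p r, ν.reg 7 = p ∧ p + r = 2 * n ∧ B' = 8 + r * E + B ∧
    (∀ x < 4, ν.reg x = μ.reg x) ∧ (∀ a, a ≠ 6 → a ≠ 7 → a ≠ 8 → ν.arr a = μ.arr a) ∧
    IsTournament I.KeyBeats (2 * n) (ν.arr 8) ∧
    (∀ q < 2 * n, ν.arr 8 (2 * n + q) = if ∃ a < p, ν.arr 6 a = q then 0 else q + 1) ∧
    SortedUpTo I p (ν.arr 6) (ν.arr 7) ∧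
    (∀ a < p, ∀ q < 2 * n, (¬ ∃ b < p, ν.arr 6 b = q) → I.KeyLe (ν.arr 6 a) q)) ?_ ?_ ?_ ?_
  · rintro B' ν ⟨p, r, -, -, rfl, -⟩
    rw [hcost]; omega
  · rintro B' ν ⟨p, r, h7, hr, rfl, hreg, harr, hT, hleaf, hsort, hmin⟩ hb
    simp only [Test.Holds, Exp.val] at hb
    have hν0 : ν.reg 0 = n := by rw [hreg 0 (by omega), h0]
    obtain ⟨r, rfl⟩ : ∃ r', r = r' + 1 := ⟨r - 1, by omega⟩
    have hpn : p < 2 * n := by omega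
    -- By pigeonhole some endpoint has not been extracted yet, so the root is not the empty entry
    -- and holds a remaining endpoint.
    obtain ⟨j₁, hj₁, hj₁'⟩ := exists_notMem_image (ν.arr 6) hpn
    have hroot := KeyBeats.root_le hT hj₁ (by
      rw [hleaf j₁ hj₁, if_neg (by push Not; exact hj₁')]; omega)
    obtain ⟨j, hj, hj'⟩ := hT.exists_leaf 1 le_rfl (by omega)
    have hjn : ¬ ∃ a < p, ν.arr 6 a = j := by
      intro h
      rw [hleaf j hj, if_pos h] at hj'
      exact hroot.1 hj'.symm
    rw [hleaf j hj, if_neg hjn] at hj'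
    have hjmin : ∀ q < 2 * n, (¬ ∃ b < p, ν.arr 6 b = q) → I.KeyLe j q := by
      intro q hq hqn
      have := (KeyBeats.root_le hT hq (by rw [hleaf q hq, if_neg hqn]; omega)).2
      rw [← hj', hleaf q hq, if_neg hqn] at this
      simpa using this
    rw [Nat.succ_mul]
    refine .seq (.of_loopFree rfl (10 + D + (10 + (8 + r * E + B)))
      (by simp [Prog.cost, Exp.cost, hcost]; omega) ?_)
    have hrun : Prog.run I.key (.seq (.seq (.set 12 (.sub (.get 8 (.lit 1)) (.lit 1)))
        (.put 6 (.reg 7) (.reg 12))) (.seq (.put 7 (.reg 12) (.reg 7))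
        (.set 4 (.add (.add (.reg 0) (.reg 0)) (.reg 12))))) ν =
        ⟨Function.update (Function.update ν.reg 12 j) 4 (2 * n + j), Function.update
          (Function.update ν.arr 6 (Function.update (ν.arr 6) p j)) 7
          (Function.update (ν.arr 7) j p)⟩ := by
      simp [Prog.run, Exp.val, ← hj', h7, hν0, two_mul]
    rw [hrun]
    refine .seq (runs_setLeaf (N := 2 * n) (n := n) (q := j) (by decide) (keyTest_holds I)
      hD (by decide) ?_ (by omega) ?_ hj ?_ ?_)
    · simpa using hν0
    · simp
    · simpa using hT
    · intro ν' hs hT' hleaf'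
      refine .of_loopFree rfl (8 + r * E + B) (by simp [Prog.cost, Exp.cost]) ?_
      have h7' : ν'.reg 7 = p := by
        rw [hs.reg 7 (by omega) (by omega) (by omega)]; simpa using h7
      have h6 : ν'.arr 6 = Function.update (ν.arr 6) p j := by
        rw [hs.arr 6 (by omega)]; simp
      have h7a : ν'.arr 7 = Function.update (ν.arr 7) j p := by
        rw [hs.arr 7 (by omega)]; simp
      have hex : ∀ q, (∃ a < p + 1, Function.update (ν.arr 6) p j a = q) ↔
          q = j ∨ ∃ a < p, ν.arr 6 a = q := by
        intro q
        constructor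
        · rintro ⟨a, ha, e⟩
          by_cases hap : a = p
          · subst hap; left; simpa using e.symm
          · right; exact ⟨a, by omega, by simpa [hap] using e⟩
        · rintro (rfl | ⟨a, ha, e⟩)
          · exact ⟨p, by omega, by simp⟩
          · exact ⟨a, by omega, by simpa [show a ≠ p by omega] using e⟩
      refine ⟨p + 1, r, ?_, by omega, rfl, fun x hx => ?_, fun a g1 g2 g3 => ?_, ?_,
        fun q hq => ?_, ⟨fun a ha => ?_, fun a ha => ?_, fun a ha b hb hab => ?_⟩,
        fun a ha q hq hqn => ?_⟩
      · simp [Prog.run, Exp.val, h7']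
      · have := hs.reg x (by omega) (by omega) (by omega)
        simp [show x ≠ 4 by omega, show x ≠ 12 by omega] at this
        simp [Prog.run, show x ≠ 7 by omega, this, hreg x hx]
      · have := hs.arr a g3
        simp [g1, g2] at this
        simp [Prog.run, this, harr a g1 g2 g3]
      · simpa [Prog.run] using hT'
      · have e := hleaf' q hq
        simp only [Prog.run, h6]
        rw [e]
        simp only [hex, Exp.val, ne_eq, Nat.reduceEqDiff, not_false_eq_true, Function.update_of_ne]
        rw [hleaf q hq]
        by_cases hqj : q = j
        · simp [hqj]
        · simp [hqj]
      · simp only [Prog.run, h6, Function.update_apply]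
        split_ifs with hap
        · exact hj
        · exact hsort.lt a (by omega)
      · simp only [Prog.run, h6, h7a, Function.update_apply]
        split_ifs with hap h h
        · exact hap.symm
        · exact absurd rfl h
        · exact absurd ⟨a, by omega, h⟩ hjn
        · exact hsort.pos_ord a (by omega)
      · simp only [Prog.run, h6, Function.update_apply]
        rw [if_neg (by omega)]
        split_ifs with hbp
        · exact hmin a (by omega) j hj hjn
        · exact hsort.le a (by omega) b (by omega) hab
      · simp only [Prog.run, h6] at hqn ⊢
        rw [hex, not_or] at hqn
        rw [Function.update_apply]
        split_ifs with hap
        · exact hjmin q hq hqn.2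
        · exact hmin a (by omega) q hq hqn.2
  · rintro B' ν ⟨p, r, h7, hr, rfl, hreg, harr, hT, hleaf, hsort, hmin⟩ hb
    simp only [Test.Holds, Exp.val] at hb
    have hν0 : ν.reg 0 = n := by rw [hreg 0 (by omega), h0]
    have hp : p = 2 * n := by omega
    subst hp
    exact ⟨by rw [hcost]; omega, hQ ν hreg harr hsort⟩
  · refine ⟨0, 2 * n, by simp [Prog.run, Exp.val], by omega, by omega, fun x hx => ?_,
      fun a _ _ _ => rfl, hT, fun q hq => ?_, ⟨?_, ?_, ?_⟩, ?_⟩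
    · simp [Prog.run, show x ≠ 7 by omega]
    · simpa [Prog.run] using hleaf q hq
    all_goals intro a ha; omega

/-! ### From the sorted arrays to a scan order -/

/-- The number of an endpoint in the input of the machine. -/
def _root_.Endpoint.num : Endpoint n → ℕ
  | .left i => i
  | .right i => n + i

theorem _root_.Endpoint.num_lt (ep : Endpoint n) : ep.num < 2 * n := by
  cases ep <;> simp only [Endpoint.num] <;> omega

theorem _root_.Endpoint.num_injective : Function.Injective (Endpoint.num (n := n)) := by
  rintro (i | i) (j | j) h <;> simp only [Endpoint.num] at h
  · rw [Fin.ext h]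
  · omega
  · omega
  · rw [Fin.ext (by omega : (i : ℕ) = j)]

theorem _root_.Endpoint.exists_num {j : ℕ} (hj : j < 2 * n) : ∃ ep : Endpoint n, ep.num = j := by
  by_cases h : j < n
  · exact ⟨.left ⟨j, h⟩, rfl⟩
  · exact ⟨.right ⟨j - n, by omega⟩, by simp only [Endpoint.num]; omega⟩

theorem key_num (I : FBAP n) (ep : Endpoint n) : I.key ep.num = ep.pos I := by
  cases ep <;> simp [key, Endpoint.num, Endpoint.pos]

theorem keyLe_num (I : FBAP n) {a b : Endpoint n} (h : I.KeyLe a.num b.num) :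
    a.MayPrecede I b := by
  unfold KeyLe at h
  rw [key_num, key_num] at h
  refine h.imp_right fun h => ⟨h.1, ?_⟩
  rintro i j ⟨rfl, rfl⟩
  exact h.2 ⟨i.2, by simp [Endpoint.num]⟩

theorem SortedUpTo.exists_scanOrder {I : FBAP n} {ord pos : ℕ → ℕ}
    (h : SortedUpTo I (2 * n) ord pos) :
    ∃ L : List (Endpoint n), I.IsScanOrder L ∧ L.length = 2 * n ∧
      ∀ ep : Endpoint n, ord (L.idxOf ep) = ep.num ∧ pos ep.num = L.idxOf ep := by
  choose f hf using fun a : Fin (2 * n) => Endpoint.exists_num (h.lt a a.2)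
  have hpf : ∀ a, pos (f a).num = a := fun a => by rw [hf, h.pos_ord a a.2]
  have hinj : Function.Injective f := fun a b hab => by
    have := hpf a
    rw [hab, hpf b] at this
    exact Fin.ext this.symm
  let g : Endpoint n → Fin (2 * n) := fun ep => ⟨ep.num, ep.num_lt⟩
  have hg : Function.Injective g := fun a b hab => Endpoint.num_injective (Fin.mk.inj hab)
  have hsurj : Function.Surjective f := fun ep => by
    -- `pos` inverts `ord`, so f is injective; numbering the endpoints turns it into an injective
    -- self-map of `Fin (2 * n)`, which is onto. Hence no endpoint is missing from the list.
    have hgf : Function.Surjective (g ∘ f) := Finite.surjective_of_injective (hg.comp hinj)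
    obtain ⟨a, ha⟩ := hgf (g ep)
    exact ⟨a, hg ha⟩
  have hnd : (List.ofFn f).Nodup := List.nodup_ofFn.2 hinj
  refine ⟨List.ofFn f, ⟨hnd, fun ep => ?_, ?_⟩, by simp, fun ep => ?_⟩
  · exact List.mem_ofFn.2 (hsurj ep)
  · rw [List.pairwise_iff_getElem]
    intro a b ha hb hab
    simp only [List.getElem_ofFn]
    rw [List.length_ofFn] at ha hb
    apply keyLe_num
    rw [hf, hf]
    exact h.le a ha b hb hab
  · obtain ⟨a, rfl⟩ := hsurj ep
    have e : (List.ofFn f).idxOf (f a) = a := by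
      have := hnd.idxOf_getElem a.1 (by simp)
      simpa using this
    rw [e]
    exact ⟨(hf a).symm, hpf a⟩

end FBAP

/-! ### The reassignment loops with a priority queue -/

namespace FBAP

variable {n : ℕ}

theorem moveOps_eq_nil_of_le {I : FBAP n} {i : Fin n} {r : ℕ} {ν : NumState n} (h : r ≤ ν.x i)
    (ks : List (Fin n)) : I.moveOps i r ks ν = [] := by
  induction ks with
  | nil => rfl
  | cons k ks ih => rw [moveOps, if_pos (by omega), ih]

theorem moveOps_eq_nil {I : FBAP n} {i : Fin n} {r : ℕ} {ν : NumState n} {ks : List (Fin n)}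
    (h : ∀ k ∈ ks, ν.x k ≤ I.rmin k) : I.moveOps i r ks ν = [] := by
  induction ks with
  | nil => rfl
  | cons k ks ih =>
    have := h k (by simp)
    rw [moveOps, if_pos (by omega), ih fun l hl => h l (by simp [hl])]

/-- A reassignment loop may start over again after a move from the furthest candidate. -/
theorem moveOps_eq_cons {I : FBAP n} {L : List (Endpoint n)} {i k : Fin n} {r : ℕ}
    {ν : NumState n} {ks : List (Fin n)} (hks : ks.Pairwise (fun k l => rpos L l < rpos L k))
    (hi : i ∉ ks) (hr : ν.x i < r) (hk : k ∈ ks) (hkx : I.rmin k < ν.x k)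
    (hfar : ∀ l ∈ ks, I.rmin l < ν.x l → rpos L l ≤ rpos L k) :
    I.moveOps i r ks ν = .move k i (min (ν.x k - I.rmin k) (r - ν.x i)) ::
      I.moveOps i r ks (ν.apply (.move k i (min (ν.x k - I.rmin k) (r - ν.x i)))) := by
  induction ks with
  | nil => simp at hk
  | cons l ks ih =>
    have hks1 := List.pairwise_cons.1 hks
    have hik : k ≠ i := fun h => hi (h ▸ hk)
    have hil : l ≠ i := by rintro rfl; simp at hi
    set m := min (ν.x k - I.rmin k) (r - ν.x i) with hm
    have xi : (ν.apply (.move k i m)).x i = ν.x i + m := by simp [NumState.apply]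
    have xk : (ν.apply (.move k i m)).x k = ν.x k - m := by simp [NumState.apply, hik]
    by_cases hlk : l = k
    · subst hlk
      rw [moveOps, if_neg (by omega)]
      congr 1
      conv_rhs => rw [moveOps]
      -- After the move either the source has no surplus or i has reached its target, so a fresh
      -- pass skips the source.
      rw [if_pos (by rw [xi, xk]; omega)]
    · have hk' : k ∈ ks := by simpa [Ne.symm hlk] using hk
      have hlx : ν.x l ≤ I.rmin l := by
        by_contra hc
        have h1 := hfar l (by simp) (by omega)
        have h2 := hks1.1 k hk'
        omega
      have xl : (ν.apply (.move k i m)).x l = ν.x l := by simp [NumState.apply, hil, hlk]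
      rw [moveOps, if_pos (by omega), ih hks1.2 (by simp at hi; exact hi.2) hk'
        (fun j hj => hfar j (by simp [hj]))]
      congr 1
      conv_rhs => rw [moveOps]
      rw [if_pos (by rw [xi, xl]; omega)]

open RAM

open Classical in
/-- The memory describes the operations `ops` executed so far, the numbers of colors `ν`, the scan
order, and the set `S` of jobs in the priority queue in array `9`. -/
structure Rep (I : FBAP n) (L : List (Endpoint n)) (ops : List (ColorOp n)) (ν : NumState n)
    (S : Finset (Fin n)) (μ : Mem) : Prop where
  n_eq : μ.reg 0 = n
  av : μ.reg 1 = ν.av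
  total : μ.reg 2 = ∑ k, ν.x k
  len : μ.reg 3 = ops.length
  rmin : ∀ k : Fin n, μ.arr 0 k = I.rmin k
  rmax : ∀ k : Fin n, μ.arr 1 k = I.rmax k
  x : ∀ k : Fin n, μ.arr 2 k = ν.x k
  code : ∀ j (h : j < ops.length), (μ.arr 3 j, μ.arr 4 j, μ.arr 5 j) = (ops[j]).code
  ord : ∀ ep : Endpoint n, μ.arr 6 (L.idxOf ep) = ep.num
  pos : ∀ ep : Endpoint n, μ.arr 7 ep.num = L.idxOf ep
  tree : IsTournament (· < ·) (2 * n) (μ.arr 9)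
  leaf : ∀ q < 2 * n, μ.arr 9 (2 * n + q) = if ∃ k ∈ S, rpos L k = q then q + 1 else 0

namespace Rep

variable {I : FBAP n} {L : List (Endpoint n)} {ops : List (ColorOp n)} {ν : NumState n}
  {S : Finset (Fin n)} {μ : Mem} {key : ℕ → ℝ}

theorem congr (h : Rep I L ops ν S μ) {μ' : Mem} (hr : ∀ x < 4, μ'.reg x = μ.reg x)
    (ha : μ'.arr = μ.arr) : Rep I L ops ν S μ' := by
  refine ⟨?_, ?_, ?_, ?_, ?_, ?_, ?_, ?_, ?_, ?_, ?_, ?_⟩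
  · rw [hr 0 (by omega)]; exact h.n_eq
  · rw [hr 1 (by omega)]; exact h.av
  · rw [hr 2 (by omega)]; exact h.total
  · rw [hr 3 (by omega)]; exact h.len
  all_goals rw [ha]
  exacts [h.rmin, h.rmax, h.x, h.code, h.ord, h.pos, h.tree, h.leaf]

theorem congr_tree (h : Rep I L ops ν S μ) {μ' : Mem} (hs : SameBut 9 μ μ') {S' : Finset (Fin n)}
    (htree : IsTournament (· < ·) (2 * n) (μ'.arr 9))
    (hleaf : ∀ q < 2 * n, (μ'.arr 9 (2 * n + q) = q + 1 ∧ ∃ k ∈ S', rpos L k = q) ∨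
      (μ'.arr 9 (2 * n + q) = 0 ∧ ¬ ∃ k ∈ S', rpos L k = q)) :
    Rep I L ops ν S' μ' := by
  refine ⟨?_, ?_, ?_, ?_, ?_, ?_, ?_, ?_, ?_, ?_, htree, fun q hq => ?_⟩
  · rw [hs.reg 0 (by omega) (by omega) (by omega)]; exact h.n_eq
  · rw [hs.reg 1 (by omega) (by omega) (by omega)]; exact h.av
  · rw [hs.reg 2 (by omega) (by omega) (by omega)]; exact h.total
  · rw [hs.reg 3 (by omega) (by omega) (by omega)]; exact h.len
  · rw [hs.arr 0 (by omega)]; exact h.rmin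
  · rw [hs.arr 1 (by omega)]; exact h.rmax
  · rw [hs.arr 2 (by omega)]; exact h.x
  · rw [hs.arr 3 (by omega), hs.arr 4 (by omega), hs.arr 5 (by omega)]; exact h.code
  · rw [hs.arr 6 (by omega)]; exact h.ord
  · rw [hs.arr 7 (by omega)]; exact h.pos
  · rcases hleaf q hq with ⟨h1, h2⟩ | ⟨h1, h2⟩
    · rw [h1, if_pos h2]
    · rw [h1, if_neg h2]

theorem root (h : Rep I L ops ν S μ) (hr : μ.arr 9 1 ≠ 0) (hn : 0 < n) :
    ∃ k ∈ S, μ.arr 9 1 = rpos L k + 1 := by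
  obtain ⟨q, hq, hq'⟩ := h.tree.exists_leaf 1 le_rfl (by omega)
  rw [h.leaf q hq] at hq'
  split_ifs at hq' with hk
  · obtain ⟨k, hk, rfl⟩ := hk
    exact ⟨k, hk, hq'.symm⟩
  · exact absurd hq'.symm hr

/-- The queue stores place + 1, larger entries winning, so the root is the queued job with the
furthest right endpoint: the algorithm's choice of donor. -/
theorem le_root (h : Rep I L ops ν S μ) (hL : I.IsScanOrder L) (hlen : L.length = 2 * n)
    {k : Fin n} (hk : k ∈ S) : rpos L k + 1 ≤ μ.arr 9 1 := by
  have hlt : rpos L k < 2 * n := hlen ▸ hL.idxOf_lt _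
  have := h.tree.root_le (le := fun x y => y ≤ x) (fun _ => le_rfl)
    (fun x y z h1 h2 => h2.trans h1) (fun x y h => h.le) (fun x y h => not_lt.1 h)
    (2 * n + rpos L k) (by omega) (by omega)
  rwa [h.leaf _ hlt, if_pos ⟨k, hk, rfl⟩] at this

end Rep

theorem code_append {ops : List (ColorOp n)} {s t m : ℕ → ℕ} (o : ColorOp n)
    (h : ∀ j (h : j < ops.length), (s j, t j, m j) = (ops[j]).code) (c₁ c₂ c₃ : ℕ)
    (ho : o.code = (c₁, c₂, c₃)) :
    ∀ j (h : j < (ops ++ [o]).length), (Function.update s ops.length c₁ j,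
      Function.update t ops.length c₂ j, Function.update m ops.length c₃ j) =
        ((ops ++ [o])[j]).code := by
  intro j hj
  rw [List.length_append, List.length_singleton] at hj
  by_cases hjl : j = ops.length
  · subst hjl
    simp [ho]
  · rw [List.getElem_append_left (by omega)]
    simpa [hjl] using h j (by omega)

/-- Add an operation to the list. -/
def emit (s t m : Exp) : Prog :=
  .seq (.seq (.put 3 (.reg 3) s) (.put 4 (.reg 3) t))
    (.seq (.put 5 (.reg 3) m) (.set 3 (.add (.reg 3) (.lit 1))))

/-- The minimum of two numbers. -/
def minExp (u v : Exp) : Exp := .sub u (.sub u v)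

theorem minExp_val (u v : Exp) (μ : Mem) : (minExp u v).val μ = min (u.val μ) (v.val μ) := by
  simp only [minExp, Exp.val]; omega

/-- Move as many colors as register `13` says from `AVAIL` to the job in register `9`. -/
def takeProg : Prog :=
  .seq (emit (.lit 0) (.add (.reg 9) (.lit 1)) (.reg 13))
    (.seq (.set 1 (.sub (.reg 1) (.reg 13))) (.seq (.set 2 (.add (.reg 2) (.reg 13)))
      (.put 2 (.reg 9) (.add (.get 2 (.reg 9)) (.reg 13)))))

theorem Rep.take {I : FBAP n} {L : List (Endpoint n)} {ops : List (ColorOp n)} {ν : NumState n}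
    {S : Finset (Fin n)} {μ : Mem} {key : ℕ → ℝ} (h : Rep I L ops ν S μ) (i : Fin n) (m : ℕ)
    (h9 : μ.reg 9 = i) (h13 : μ.reg 13 = m) :
    Rep I L (ops ++ [.take i m]) (ν.apply (.take i m)) S (takeProg.run key μ) ∧
      ∀ x, 4 ≤ x → (takeProg.run key μ).reg x = μ.reg x := by
  have e : takeProg.run key μ = ⟨Function.update (Function.update (Function.update μ.reg 3
      (ops.length + 1)) 1 (ν.av - m)) 2 ((∑ k, ν.x k) + m),
      Function.update (Function.update (Function.update (Function.update μ.arr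
        3 (Function.update (μ.arr 3) ops.length 0))
        4 (Function.update (μ.arr 4) ops.length (i + 1)))
        5 (Function.update (μ.arr 5) ops.length m))
        2 (Function.update (μ.arr 2) i (ν.x i + m))⟩ := by
    simp [takeProg, emit, Prog.run, Exp.val, h9, h13, h.len, h.av, h.total, h.x]
  rw [e]
  refine ⟨⟨?_, ?_, ?_, ?_, ?_, ?_, fun k => ?_, ?_, ?_, ?_, ?_, ?_⟩, fun x hx => ?_⟩
  · simpa using h.n_eq
  · simp [NumState.apply]
  · simp only [Function.update_self, NumState.apply]
    rw [Finset.sum_update_of_mem (Finset.mem_univ i), ← Finset.add_sum_erase _ _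
      (Finset.mem_univ i), Finset.sdiff_singleton_eq_erase]
    omega
  · simp
  · simpa using h.rmin
  · simpa using h.rmax
  · have := h.x k
    simp only [Function.update_self, NumState.apply, Function.update_apply, Fin.val_inj, this]
  · simpa using code_append (.take i m) h.code 0 (i + 1) m rfl
  · simpa using h.ord
  · simpa using h.pos
  · simpa using h.tree
  · simpa using h.leaf
  · simp [show x ≠ 1 by omega, show x ≠ 2 by omega, show x ≠ 3 by omega]

/-- Move colors from the job in the root of the queue to the job in register `9`, which should get
as many as register `10` says. -/
def moveProg : Prog :=
  .seq (.seq (.set 12 (.sub (.get 6 (.sub (.get 9 (.lit 1)) (.lit 1))) (.reg 0)))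
      (.set 13 (minExp (.sub (.get 2 (.reg 12)) (.get 0 (.reg 12)))
        (.sub (.reg 10) (.get 2 (.reg 9))))))
    (.seq (emit (.add (.reg 12) (.lit 1)) (.add (.reg 9) (.lit 1)) (.reg 13))
      (.seq (.put 2 (.reg 12) (.sub (.get 2 (.reg 12)) (.reg 13)))
        (.put 2 (.reg 9) (.add (.get 2 (.reg 9)) (.reg 13)))))

theorem Rep.move {I : FBAP n} {L : List (Endpoint n)} {ops : List (ColorOp n)} {ν : NumState n}
    {S : Finset (Fin n)} {μ : Mem} {key : ℕ → ℝ} (h : Rep I L ops ν S μ) {i k : Fin n} (m : ℕ)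
    (hm : m = min (ν.x k - I.rmin k) (μ.reg 10 - ν.x i)) (h9 : μ.reg 9 = i) (hki : k ≠ i)
    (hroot : μ.arr 9 1 = rpos L k + 1) :
    Rep I L (ops ++ [.move k i m]) (ν.apply (.move k i m)) S (moveProg.run key μ) ∧
      (∀ x, 4 ≤ x → x ≠ 12 → x ≠ 13 → (moveProg.run key μ).reg x = μ.reg x) ∧
      (moveProg.run key μ).reg 12 = k ∧ (moveProg.run key μ).arr 9 = μ.arr 9 := by
  have hk : μ.arr 6 (rpos L k) = n + k := h.ord (.right k)
  have hki' : (k : ℕ) ≠ i := fun h => hki (Fin.ext h)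
  have e : moveProg.run key μ = ⟨Function.update (Function.update (Function.update μ.reg
      12 k) 13 m) 3 (ops.length + 1),
      Function.update (Function.update (Function.update (Function.update μ.arr
        3 (Function.update (μ.arr 3) ops.length (k + 1)))
        4 (Function.update (μ.arr 4) ops.length (i + 1)))
        5 (Function.update (μ.arr 5) ops.length m))
        2 (Function.update (Function.update (μ.arr 2) k (ν.x k - m)) i (ν.x i + m))⟩ := by
    simp [moveProg, emit, Prog.run, Exp.val, minExp_val, h9, hroot, hk, h.n_eq, h.len, h.x,
      h.rmin, ← hm, hki'.symm]
  rw [e]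
  refine ⟨⟨?_, ?_, ?_, ?_, ?_, ?_, fun l => ?_, ?_, ?_, ?_, ?_, ?_⟩, fun x hx g1 g2 => ?_, ?_, ?_⟩
  · simpa using h.n_eq
  · simpa [NumState.apply] using h.av
  · have h2 := h.total
    simp only [ne_eq, Nat.reduceEqDiff, not_false_eq_true, Function.update_of_ne, NumState.apply]
    rw [h2, Finset.sum_update_of_mem (Finset.mem_univ i),
      Finset.sum_update_of_mem (by simp [hki]),
      ← Finset.add_sum_erase _ _ (Finset.mem_univ i), ← Finset.sdiff_singleton_eq_erase,
      ← Finset.add_sum_erase _ _ (show k ∈ _ by simp [hki]), ← Finset.sdiff_singleton_eq_erase]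
    omega
  · simp
  · simpa using h.rmin
  · simpa using h.rmax
  · have := h.x l
    simp only [Function.update_self, NumState.apply, Function.update_apply, Fin.val_inj, this]
  · simpa using code_append (.move k i m) h.code (k + 1) (i + 1) m rfl
  · simpa using h.ord
  · simpa using h.pos
  · simpa using h.tree
  · simpa using h.leaf
  · simp [show x ≠ 3 by omega, g1, g2]
  · simp
  · simp

/-- Release the colors of the job whose right endpoint is in register `9`. -/
def releaseProg : Prog :=
  .seq (.set 9 (.sub (.reg 9) (.reg 0)))
    (.seq (emit (.add (.reg 9) (.lit 1)) (.lit 0) (.lit 0))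
      (.set 1 (.add (.reg 1) (.get 2 (.reg 9)))))

theorem Rep.release {I : FBAP n} {L : List (Endpoint n)} {ops : List (ColorOp n)} {ν : NumState n}
    {S : Finset (Fin n)} {μ : Mem} {key : ℕ → ℝ} (h : Rep I L ops ν S μ) {i : Fin n}
    (h9 : μ.reg 9 = n + i) :
    Rep I L (ops ++ [.release i]) (ν.apply (.release i)) S (releaseProg.run key μ) ∧
      (∀ x, 4 ≤ x → x ≠ 9 → (releaseProg.run key μ).reg x = μ.reg x) ∧
      (releaseProg.run key μ).arr 9 = μ.arr 9 := by
  have e : releaseProg.run key μ = ⟨Function.update (Function.update (Function.update μ.reg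
      9 i) 3 (ops.length + 1)) 1 (ν.av + ν.x i),
      Function.update (Function.update (Function.update μ.arr
        3 (Function.update (μ.arr 3) ops.length (i + 1)))
        4 (Function.update (μ.arr 4) ops.length 0))
        5 (Function.update (μ.arr 5) ops.length 0)⟩ := by
    simp [releaseProg, emit, Prog.run, Exp.val, h9, h.n_eq, h.len, h.x, h.av]
  rw [e]
  refine ⟨⟨?_, ?_, ?_, ?_, ?_, ?_, ?_, ?_, ?_, ?_, ?_, ?_⟩, fun x hx g1 => ?_, ?_⟩
  · simpa using h.n_eq
  · simp [NumState.apply]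
  · simpa [NumState.apply] using h.total
  · simp
  · simpa using h.rmin
  · simpa using h.rmax
  · simpa [NumState.apply] using h.x
  · simpa using code_append (.release i) h.code (i + 1) 0 0 rfl
  · simpa using h.ord
  · simpa using h.pos
  · simpa using h.tree
  · simpa using h.leaf
  · simp [show x ≠ 3 by omega, show x ≠ 1 by omega, g1]
  · simp

/-- The test for the order of the queue. -/
def queueTest : Test := .lt (.reg 5) (.reg 6)

theorem queueTest_holds (key : ℕ → ℝ) (n : ℕ) (μ : Mem) (_ : μ.reg 0 = n) :
    queueTest.Holds key μ ↔ μ.reg 5 < μ.reg 6 := Iff.rfl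

/-- Delete a job from the queue; register `4` holds its leaf. -/
theorem Rep.runs_delete {I : FBAP n} {L : List (Endpoint n)} {ops : List (ColorOp n)}
    {ν : NumState n} {S : Finset (Fin n)} {μ : Mem} {key : ℕ → ℝ} (h : Rep I L ops ν S μ)
    (hL : I.IsScanOrder L) (hlen : L.length = 2 * n) (k : Fin n) {d D : ℕ}
    (hD : D = 100 * (d + 1)) (hd : 4 * n ≤ 2 ^ (d + 1)) (h4 : μ.reg 4 = 2 * n + rpos L k)
    {B : ℕ} {Q : ℕ → Mem → Prop}
    (hQ : ∀ μ', SameBut 9 μ μ' → Rep I L ops ν (S.erase k) μ' → Q B μ') :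
    Runs key (setLeaf 9 queueTest (.lit 0)) μ (10 + D + B) Q := by
  refine runs_setLeaf (N := 2 * n) (n := n) (by decide) (queueTest_holds key n) hD (by decide)
    h.n_eq (by omega) h4 (hlen ▸ hL.idxOf_lt _) h.tree fun μ' hs hT hleaf => ?_
  refine hQ μ' hs (h.congr_tree hs hT fun q hq => ?_)
  rw [hleaf q hq]
  by_cases hqk : q = rpos L k
  · refine Or.inr ⟨by rw [if_pos hqk]; rfl, ?_⟩
    rintro ⟨l, hl, hl'⟩
    exact (Finset.mem_erase.1 hl).1 (hL.rpos_inj.1 (hl'.trans hqk))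
  · rw [if_neg hqk, h.leaf q hq]
    split_ifs with hex
    · obtain ⟨l, hl, hl'⟩ := hex
      exact Or.inl ⟨rfl, l, Finset.mem_erase.2 ⟨by rintro rfl; exact hqk hl'.symm, hl⟩, hl'⟩
    · exact Or.inr ⟨rfl, fun ⟨l, hl, hl'⟩ => hex ⟨l, (Finset.mem_erase.1 hl).2, hl'⟩⟩

/-- Insert a job into the queue; register `4` holds its leaf. -/
theorem Rep.runs_insert {I : FBAP n} {L : List (Endpoint n)} {ops : List (ColorOp n)}
    {ν : NumState n} {S : Finset (Fin n)} {μ : Mem} {key : ℕ → ℝ} (h : Rep I L ops ν S μ)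
    (hL : I.IsScanOrder L) (hlen : L.length = 2 * n) (k : Fin n) {d D : ℕ}
    (hD : D = 100 * (d + 1)) (hd : 4 * n ≤ 2 ^ (d + 1)) (h4 : μ.reg 4 = 2 * n + rpos L k)
    {u : Exp} (hu : u.cost ≤ 8) (huv : u.val μ = rpos L k + 1) {B : ℕ} {Q : ℕ → Mem → Prop}
    (hQ : ∀ μ', SameBut 9 μ μ' → Rep I L ops ν (insert k S) μ' → Q B μ') :
    Runs key (setLeaf 9 queueTest u) μ (10 + D + B) Q := by
  refine runs_setLeaf (N := 2 * n) (n := n) (by decide) (queueTest_holds key n) hD hu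
    h.n_eq (by omega) h4 (hlen ▸ hL.idxOf_lt _) h.tree fun μ' hs hT hleaf => ?_
  refine hQ μ' hs (h.congr_tree hs hT fun q hq => ?_)
  rw [hleaf q hq, huv]
  by_cases hqk : q = rpos L k
  · exact Or.inl ⟨by rw [if_pos hqk, hqk], k, by simp, hqk.symm⟩
  · rw [if_neg hqk, h.leaf q hq]
    split_ifs with hex
    · obtain ⟨l, hl, hl'⟩ := hex
      exact Or.inl ⟨rfl, l, Finset.mem_insert_of_mem hl, hl'⟩
    · refine Or.inr ⟨rfl, fun ⟨l, hl, hl'⟩ => ?_⟩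
      rcases Finset.mem_insert.1 hl with rfl | hl
      · exact hqk hl'.symm
      · exact hex ⟨l, hl, hl'⟩

/-- The reassignment loop for the job in register `9`, which should get as many colors as
register `10` says, from jobs whose right endpoints lie at places not before register `11`. -/
def moveLoop : Prog :=
  .loop (.and (.lt (.get 2 (.reg 9)) (.reg 10)) (.lt (.reg 11) (.get 9 (.lit 1))))
    (.seq moveProg (.ite (.lt (.get 0 (.reg 12)) (.get 2 (.reg 12))) .skip
      (.seq (.set 4 (.add (.add (.reg 0) (.reg 0)) (.sub (.get 9 (.lit 1)) (.lit 1))))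
        (setLeaf 9 queueTest (.lit 0)))))

/-- Amortization: every queued job carries a credit `E`, enough for one round including a deletion.
A round that removes the donor is paid by the donor's credit. If the donor keeps a surplus, i has
reached its target, so this happens at most once and is paid by the extra `E`. -/
theorem Rep.runs_moveLoop {I : FBAP n} {L : List (Endpoint n)} {ops : List (ColorOp n)}
    {S : Finset (Fin n)} {μ : Mem} {key : ℕ → ℝ} (h : Rep I L ops (I.exec ops) S μ)
    (hL : I.IsScanOrder L) (hlen : L.length = 2 * n) {d D E : ℕ}
    (hD : D = 100 * (d + 1)) (hE : E = D + 150) (hd : 4 * n ≤ 2 ^ (d + 1)) {i : Fin n} {r θ : ℕ}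
    {ks : List (Fin n)} (hks : ks.Pairwise (fun k l => rpos L l < rpos L k)) (hi : i ∉ ks)
    (hiS : i ∉ S) (h9 : μ.reg 9 = i) (h10 : μ.reg 10 = r) (h11 : μ.reg 11 = θ)
    (hS : ∀ k ∈ S, I.rmin k < (I.exec ops).x k)
    (hSks : ∀ k, k ∈ S ∧ θ < rpos L k + 1 ↔ k ∈ ks ∧ I.rmin k < (I.exec ops).x k)
    {B : ℕ} {Q : ℕ → Mem → Prop}
    (hQ : ∀ ops' S' μ', ops' = ops ++ I.moveOps i r ks (I.exec ops) →
      (∀ k, k ∈ S' ↔ k ∈ S ∧ I.rmin k < (I.exec ops').x k) →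
      Rep I L ops' (I.exec ops') S' μ' → μ'.reg 8 = μ.reg 8 → μ'.reg 9 = μ.reg 9 →
      Q (E * S'.card + B) μ') :
    Runs key moveLoop μ (E * S.card + E + 10 + B) Q := by
  classical
  have hn : 0 < n := i.pos
  have hcost : (Test.and (.lt (.get 2 (.reg 9)) (.reg 10))
    (.lt (.reg 11) (.get 9 (.lit 1)))).cost = 9 := rfl
  refine .mono (Q := fun B' ν => ∃ B'' ≤ B', Q B'' ν) ?_ fun B' ν h => h
  refine .loop (fun B' ν => ∃ ops₁ S₁, Rep I L ops₁ (I.exec ops₁) S₁ ν ∧ ν.reg 8 = μ.reg 8 ∧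
    ν.reg 9 = i ∧ ν.reg 10 = r ∧ ν.reg 11 = θ ∧
    ops₁ ++ I.moveOps i r ks (I.exec ops₁) = ops ++ I.moveOps i r ks (I.exec ops) ∧
    (∀ k, k ∈ S₁ ↔ k ∈ S ∧ I.rmin k < (I.exec ops₁).x k) ∧
    (∀ k, k ∈ S₁ ∧ θ < rpos L k + 1 ↔ k ∈ ks ∧ I.rmin k < (I.exec ops₁).x k) ∧
    E * S₁.card + (if (I.exec ops₁).x i < r then E else 0) + 10 + B ≤ B') ?_ ?_ ?_ ?_
  · rintro B' ν ⟨ops₁, S₁, -, -, -, -, -, -, -, -, hB⟩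
    rw [hcost]; omega
  · rintro B' ν ⟨ops₁, S₁, hR, g8, g9, g10, g11, hops, hS₁, hSks₁, hB⟩ hb
    simp only [Test.Holds, Exp.val, g9, g10, g11, hR.x] at hb
    obtain ⟨hxr, hroot⟩ := hb
    rw [if_pos hxr] at hB
    obtain ⟨k, hk, hroot'⟩ := hR.root (by omega) hn
    have hkks := (hSks₁ k).1 ⟨hk, by omega⟩
    have hki : k ≠ i := fun h => hi (h ▸ hkks.1)
    obtain ⟨m, hm⟩ : ∃ m, m = min ((I.exec ops₁).x k - I.rmin k) (r - (I.exec ops₁).x i) :=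
      ⟨_, rfl⟩
    -- The entries beyond the threshold are exactly the candidates with a surplus, so the root is
    -- the furthest of these and yields the next operation of the abstract loop.
    have hstep := moveOps_eq_cons hks hi hxr hkks.1 hkks.2 (fun l hl hl' => by
      have := hR.le_root hL hlen ((hSks₁ l).2 ⟨hl, hl'⟩).1
      omega)
    rw [← hm] at hstep
    rw [hcost]
    refine .seq (.of_loopFree rfl (E * S₁.card + E + 10 + B - 10 - 60) ?_ ?_)
    · simp [moveProg, emit, minExp, Prog.cost, Exp.cost]; omega
    obtain ⟨hR', hreg, h12, harr⟩ := hR.move (key := key) m (by rw [hm, g10]) g9 hki hroot'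
    generalize moveProg.run key ν = ν₂ at *
    rw [hstep] at hops
    have hexec : (I.exec ops₁).apply (.move k i m) = I.exec (ops₁ ++ [.move k i m]) := by
      rw [exec_append]; rfl
    have xi : (I.exec (ops₁ ++ [.move k i m])).x i = (I.exec ops₁).x i + m := by
      rw [← hexec]; simp [NumState.apply]
    have xk : (I.exec (ops₁ ++ [.move k i m])).x k = (I.exec ops₁).x k - m := by
      rw [← hexec]; simp [NumState.apply, hki]
    have xo : ∀ l, l ≠ i → l ≠ k →
        (I.exec (ops₁ ++ [.move k i m])).x l = (I.exec ops₁).x l := by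
      intro l h1 h2; rw [← hexec]; simp [NumState.apply, h1, h2]
    rw [hexec] at hR' hops
    rw [← List.singleton_append, ← List.append_assoc] at hops
    have hiS₁ : i ∉ S₁ := fun h => hiS ((hS₁ i).1 h).1
    generalize ops₁ ++ [.move k i m] = ops₂ at *
    refine .ite (E * S₁.card + E + 10 + B - 80) (by simp [Test.cost, Exp.cost]; omega) ?_ ?_
    · intro hlt
      simp only [Test.Holds, Exp.val, h12, hR'.x, hR'.rmin] at hlt
      refine .of_loopFree rfl (E * S₁.card + E + 10 + B - 81) (by simp [Prog.cost]; omega) ?_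
      refine ⟨ops₂, S₁, hR', ?_, ?_, ?_, ?_, hops, fun l => ?_, fun l => ?_, ?_⟩
      · rw [← g8]; exact hreg 8 (by omega) (by omega) (by omega)
      · rw [← g9]; exact hreg 9 (by omega) (by omega) (by omega)
      · rw [← g10]; exact hreg 10 (by omega) (by omega) (by omega)
      · rw [← g11]; exact hreg 11 (by omega) (by omega) (by omega)
      · by_cases hlk : l = k
        · subst hlk
          exact ⟨fun h => ⟨((hS₁ l).1 h).1, hlt⟩, fun _ => hk⟩
        · by_cases hli : l = i
          · subst hli
            exact ⟨fun h => absurd h hiS₁, fun h => absurd h.1 hiS⟩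
          · rw [xo l hli hlk]; exact hS₁ l
      · by_cases hlk : l = k
        · subst hlk
          exact ⟨fun _ => ⟨hkks.1, hlt⟩, fun _ => ⟨hk, by omega⟩⟩
        · by_cases hli : l = i
          · subst hli
            exact ⟨fun h => absurd h.1 hiS₁, fun h => absurd h.1 hi⟩
          · rw [xo l hli hlk]; exact hSks₁ l
      -- The donor still has a surplus, so the move was limited by the demand of i: the target is
      -- met and the extra credit is spent.
      · rw [if_neg (by omega)]
        omega
    · intro hlt
      simp only [Test.Holds, Exp.val, h12, hR'.x, hR'.rmin] at hlt
      have hcard : S₁.card = (S₁.erase k).card + 1 := (Finset.card_erase_add_one hk).symm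
      have hmul : E * S₁.card = E * (S₁.erase k).card + E := by rw [hcard, Nat.mul_succ]
      refine .seq (.of_loopFree rfl (10 + D + (E * (S₁.erase k).card + E + 10 + B))
        (by simp [Prog.cost, Exp.cost]; omega) ?_)
      refine Rep.runs_delete (I := I) (L := L) (ops := ops₂) (ν := I.exec ops₂) (S := S₁)
        (hR'.congr (fun x hx => ?_) ?_) hL hlen k hD hd ?_ fun μ' hs hμ' => ?_
      · simp [Prog.run, show x ≠ 4 by omega]
      · simp [Prog.run]
      · simp [Prog.run, Exp.val, harr, hroot', hR'.n_eq]; omega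
      · have hreg' : ∀ x, 8 ≤ x → x < 12 → μ'.reg x = ν.reg x := by
          intro x h1 h2
          rw [hs.reg x (by omega) (by omega) (by omega)]
          simp only [Prog.run]
          rw [Function.update_of_ne (by omega), hreg x (by omega) (by omega) (by omega)]
        refine ⟨ops₂, S₁.erase k, hμ', ?_, ?_, ?_, ?_, hops, fun l => ?_, fun l => ?_, ?_⟩
        · rw [hreg' 8 (by omega) (by omega), g8]
        · rw [hreg' 9 (by omega) (by omega), g9]
        · rw [hreg' 10 (by omega) (by omega), g10]
        · rw [hreg' 11 (by omega) (by omega), g11]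
        · by_cases hlk : l = k
          · subst hlk
            simp [hlt]
          · rw [Finset.mem_erase, and_iff_right hlk]
            by_cases hli : l = i
            · subst hli
              exact ⟨fun h => absurd h hiS₁, fun h => absurd h.1 hiS⟩
            · rw [xo l hli hlk]; exact hS₁ l
        · by_cases hlk : l = k
          · subst hlk
            simp [hlt]
          · rw [Finset.mem_erase, and_iff_right hlk]
            by_cases hli : l = i
            · subst hli
              exact ⟨fun h => absurd h.1 hiS₁, fun h => absurd h.1 hi⟩
            · rw [xo l hli hlk]; exact hSks₁ l
        · split_ifs <;> omega
  · rintro B' ν ⟨ops₁, S₁, hR, g8, g9, g10, g11, hops, hS₁, hSks₁, hB⟩ hb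
    simp only [Test.Holds, Exp.val, g9, g10, g11, hR.x] at hb
    have hnil : I.moveOps i r ks (I.exec ops₁) = [] := by
      by_cases hxr : (I.exec ops₁).x i < r
      · refine moveOps_eq_nil fun k hk => ?_
        by_contra hc
        obtain ⟨h1, h2⟩ := (hSks₁ k).2 ⟨hk, not_le.1 hc⟩
        have := hR.le_root hL hlen h1
        exact hb ⟨hxr, by omega⟩
      · exact moveOps_eq_nil_of_le (not_lt.1 hxr) ks
    rw [hnil, List.append_nil] at hops
    rw [hcost]
    exact ⟨_, by omega, hQ ops₁ S₁ ν hops hS₁ hR g8 (by rw [g9, h9])⟩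
  · refine ⟨ops, S, h, rfl, h9, h10, h11, rfl, fun k => ⟨fun hk => ⟨hk, hS k hk⟩, fun hk => hk.1⟩,
      hSks, ?_⟩
    split_ifs <;> omega

end FBAP

/-! ### The complete program and its running time -/

namespace FBAP

variable {n : ℕ}

open RAM

/-- Take available colors for the job in register `9`, at most as many as `u` says, and prepare
a reassignment loop. -/
def prepareProg (u r θ : Exp) : Prog :=
  .seq (.set 13 (minExp (.reg 1) u)) (.seq takeProg (.seq (.set 10 r) (.set 11 θ)))

/-- The left endpoint of the job in register `9` is scanned. -/
def leftProg : Prog :=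
  .seq (prepareProg (.get 0 (.reg 9)) (.get 0 (.reg 9)) (.lit 0))
    (.seq moveLoop
      (.seq (prepareProg (.sub (.get 1 (.reg 9)) (.get 0 (.reg 9))) (.get 1 (.reg 9))
          (.add (.get 7 (.add (.reg 0) (.reg 9))) (.lit 1)))
        (.seq moveLoop
          (.ite (.lt (.get 0 (.reg 9)) (.get 2 (.reg 9)))
            (.seq (.set 4 (.add (.add (.reg 0) (.reg 0)) (.get 7 (.add (.reg 0) (.reg 9)))))
              (setLeaf 9 queueTest (.add (.get 7 (.add (.reg 0) (.reg 9))) (.lit 1)))) .skip))))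

theorem Rep.prepare {I : FBAP n} {L : List (Endpoint n)} {ops : List (ColorOp n)} {ν : NumState n}
    {S : Finset (Fin n)} {μ : Mem} {key : ℕ → ℝ} (h : Rep I L ops ν S μ) (i : Fin n) (m : ℕ)
    (h9 : μ.reg 9 = i) {u r θ : Exp} {r' θ' : ℕ} (hm : min ν.av (u.val μ) = m)
    (hr : ∀ μ' : Mem, Rep I L (ops ++ [.take i m]) (ν.apply (.take i m)) S μ' → μ'.reg 9 = i →
      r.val μ' = r')
    (hθ : ∀ μ' : Mem, Rep I L (ops ++ [.take i m]) (ν.apply (.take i m)) S μ' → μ'.reg 9 = i →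
      θ.val μ' = θ') :
    Rep I L (ops ++ [.take i m]) (ν.apply (.take i m)) S ((prepareProg u r θ).run key μ) ∧
      ((prepareProg u r θ).run key μ).reg 8 = μ.reg 8 ∧
      ((prepareProg u r θ).run key μ).reg 9 = i ∧
      ((prepareProg u r θ).run key μ).reg 10 = r' ∧
      ((prepareProg u r θ).run key μ).reg 11 = θ' := by
  obtain ⟨μ₁, hμ₁⟩ : ∃ μ₁, μ₁ = (Prog.set 13 (minExp (.reg 1) u)).run key μ := ⟨_, rfl⟩
  have h1 : Rep I L ops ν S μ₁ := h.congr (fun x hx => by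
    rw [hμ₁]; simp [Prog.run, show x ≠ 13 by omega]) (by rw [hμ₁]; rfl)
  have g13 : μ₁.reg 13 = m := by
    rw [hμ₁]; simp [Prog.run, minExp_val, Exp.val, h.av, hm]
  have g9 : μ₁.reg 9 = i := by rw [hμ₁]; simp [Prog.run, h9]
  have g8 : μ₁.reg 8 = μ.reg 8 := by rw [hμ₁]; simp [Prog.run]
  obtain ⟨h2, hreg⟩ := h1.take (key := key) i m g9 g13
  obtain ⟨μ₂, hμ₂⟩ : ∃ μ₂, μ₂ = takeProg.run key μ₁ := ⟨_, rfl⟩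
  rw [← hμ₂] at h2 hreg
  have f9 : μ₂.reg 9 = i := by rw [hreg 9 (by omega), g9]
  have f8 : μ₂.reg 8 = μ.reg 8 := by rw [hreg 8 (by omega), g8]
  obtain ⟨μ₃, hμ₃⟩ : ∃ μ₃, μ₃ = (Prog.set 10 r).run key μ₂ := ⟨_, rfl⟩
  have h3 : Rep I L (ops ++ [.take i m]) (ν.apply (.take i m)) S μ₃ := h2.congr (fun x hx => by
    rw [hμ₃]; simp [Prog.run, show x ≠ 10 by omega]) (by rw [hμ₃]; rfl)
  have e : (prepareProg u r θ).run key μ = (Prog.set 11 θ).run key μ₃ := by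
    rw [hμ₃, hμ₂, hμ₁]; rfl
  have e9 : μ₃.reg 9 = i := by rw [hμ₃]; simp [Prog.run, f9]
  rw [e]
  refine ⟨h3.congr (fun x hx => by simp [Prog.run, show x ≠ 11 by omega]) rfl, ?_, ?_, ?_, ?_⟩
  · simp [Prog.run, hμ₃, f8]
  · simp [Prog.run, e9]
  · simp [Prog.run, hμ₃, hr μ₂ h2 f9]
  · simp [Prog.run, hθ μ₃ h3 e9]

/-- The same queue serves both loops, with threshold 0 and then `rpos L i + 1`. Job i enters it only
afterwards, so it never donates to itself. Of the credit `4 * E`, one `E` goes to each loop, one to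
the insertion of i, and one becomes the credit that i carries in the queue. -/
theorem Rep.runs_left {I : FBAP n} {L : List (Endpoint n)} {ops : List (ColorOp n)}
    {S : Finset (Fin n)} {μ : Mem} {key : ℕ → ℝ} (h : Rep I L ops (I.exec ops) S μ)
    (hL : I.IsScanOrder L) (hlen : L.length = 2 * n) {d D E : ℕ}
    (hD : D = 100 * (d + 1)) (hE : E = D + 150) (hd : 4 * n ≤ 2 ^ (d + 1)) (i : Fin n)
    (h9 : μ.reg 9 = i) (hS : ∀ k, k ∈ S ↔ lpos L k < lpos L i ∧ lpos L i < rpos L k ∧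
      I.rmin k < (I.exec ops).x k) {B : ℕ} {Q : ℕ → Mem → Prop}
    (hQ : ∀ ops' S' μ', ops' = ops ++ I.scanOps L (I.exec ops) (.left i) →
      (∀ k, k ∈ S' ↔ lpos L k ≤ lpos L i ∧ lpos L i < rpos L k ∧
        I.rmin k < (I.exec ops').x k) →
      Rep I L ops' (I.exec ops') S' μ' → μ'.reg 8 = μ.reg 8 → Q (E * S'.card + B) μ') :
    Runs key leftProg μ (E * S.card + (4 * E + 300) + B) Q := by
  classical
  have hi := hL.lpos_lt_rpos i
  have c2 : ∀ k, k ∈ candidates L i (.left i) ↔ _ := fun k => hL.mem_candidates_left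
  have c4 : ∀ k, k ∈ candidates L i (.right i) ↔ _ := fun k => hL.mem_candidates_right
  have n2 : i ∉ candidates L i (.left i) := fun hk => by have := (c2 i).1 hk; omega
  have n4 : i ∉ candidates L i (.right i) := fun hk => by have := (c4 i).1 hk; omega
  have hiS : i ∉ S := fun hk => by have := (hS i).1 hk; omega
  obtain ⟨h1, f8, f9, f10, f11⟩ := h.prepare (key := key) i (min (I.exec ops).av (I.rmin i)) h9
    (u := .get 0 (.reg 9)) (r := .get 0 (.reg 9)) (θ := .lit 0) (r' := I.rmin i) (θ' := 0)
    (by simp [Exp.val, h9, h.rmin]) (fun μ' hR g9 => by simp [Exp.val, g9, hR.rmin])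
    (fun μ' _ _ => rfl)
  refine .seq (.of_loopFree rfl (E * S.card + E + 10 + (3 * E + 100 + B)) ?_ ?_)
  · simp [prepareProg, takeProg, emit, minExp, Prog.cost, Exp.cost]; omega
  generalize Prog.run key _ μ = μ₁ at *
  have hx1 : (I.exec ops).apply (I.takeMin i (I.exec ops)) =
      I.exec (ops ++ [I.takeMin i (I.exec ops)]) := by rw [exec_append]; rfl
  have xo1 : ∀ k, k ≠ i → (I.exec (ops ++ [I.takeMin i (I.exec ops)])).x k =
      (I.exec ops).x k := by
    intro k hk; rw [← hx1]; simp [NumState.apply, takeMin, hk]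
  change Rep I L (ops ++ [I.takeMin i (I.exec ops)]) ((I.exec ops).apply
    (I.takeMin i (I.exec ops))) S μ₁ at h1
  rw [hx1] at h1
  obtain ⟨ops₁, hops₁⟩ : ∃ o, o = ops ++ [I.takeMin i (I.exec ops)] := ⟨_, rfl⟩
  rw [← hops₁] at hx1 xo1 h1
  refine .seq (h1.runs_moveLoop hL hlen hD hE hd (hL.candidates_pairwise _ _) n2 hiS f9 f10 f11
    (fun k hk => ?_) (fun k => ?_) fun ops₂ S₂ μ₂ hops₂ hS₂ h2 g8 g9 => ?_)
  · rw [xo1 k (fun h => hiS (h ▸ hk))]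
    exact ((hS k).1 hk).2.2
  · rw [hS, c2]
    by_cases hki : k = i
    · subst hki; simp
    · rw [xo1 k hki]
      constructor
      · exact fun h => ⟨⟨h.1.1, h.1.2.1⟩, h.1.2.2⟩
      · exact fun h => ⟨⟨h.1.1, h.1.2, h.2⟩, by omega⟩
  have S2 := moveNum_spec I L i (I.rmin i) (candidates L i (.left i)) n2
    (hL.candidates_pairwise _ _) (I.exec ops₁)
  have hx2 : I.moveNum i (I.rmin i) (candidates L i (.left i)) (I.exec ops₁) = I.exec ops₂ := by
    rw [hops₂, exec_append]; rfl
  rw [hx2] at S2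
  obtain ⟨h3, f8', f9', f10', f11'⟩ := h2.prepare (key := key) i
    (min (I.exec ops₂).av (I.rmax i - I.rmin i)) (g9.trans f9)
    (u := .sub (.get 1 (.reg 9)) (.get 0 (.reg 9))) (r := .get 1 (.reg 9))
    (θ := .add (.get 7 (.add (.reg 0) (.reg 9))) (.lit 1)) (r' := I.rmax i)
    (θ' := rpos L i + 1)
    (by simp [Exp.val, g9, f9, h2.rmin, h2.rmax]) (fun μ' hR g9 => by simp [Exp.val, g9, hR.rmax])
    (fun μ' hR g9 => by
      have : μ'.arr 7 (n + i) = rpos L i := hR.pos (.right i)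
      simp [Exp.val, g9, hR.n_eq, this])
  refine .seq (.of_loopFree rfl (E * S₂.card + E + 10 + (2 * E + B)) ?_ ?_)
  · simp [prepareProg, takeProg, emit, minExp, Prog.cost, Exp.cost]; omega
  generalize Prog.run key _ μ₂ = μ₃ at *
  have hx3 : (I.exec ops₂).apply (I.takeMax i (I.exec ops₂)) =
      I.exec (ops₂ ++ [I.takeMax i (I.exec ops₂)]) := by rw [exec_append]; rfl
  have xo3 : ∀ k, k ≠ i → (I.exec (ops₂ ++ [I.takeMax i (I.exec ops₂)])).x k =
      (I.exec ops₂).x k := by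
    intro k hk; rw [← hx3]; simp [NumState.apply, takeMax, hk]
  change Rep I L (ops₂ ++ [I.takeMax i (I.exec ops₂)]) ((I.exec ops₂).apply
    (I.takeMax i (I.exec ops₂))) S₂ μ₃ at h3
  rw [hx3] at h3
  obtain ⟨ops₃, hops₃⟩ : ∃ o, o = ops₂ ++ [I.takeMax i (I.exec ops₂)] := ⟨_, rfl⟩
  rw [← hops₃] at hx3 xo3 h3
  have hiS₂ : i ∉ S₂ := fun hk => hiS ((hS₂ i).1 hk).1
  refine .seq (h3.runs_moveLoop hL hlen hD hE hd (hL.candidates_pairwise _ _) n4 hiS₂ f9' f10'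
    f11' (fun k hk => ?_) (fun k => ?_) fun ops₄ S₄ μ₄ hops₄ hS₄ h4 g8' g9' => ?_)
  · rw [xo3 k (fun h => hiS₂ (h ▸ hk))]
    exact ((hS₂ k).1 hk).2
  · rw [hS₂, hS, c4]
    by_cases hki : k = i
    · subst hki; simp
    · have := S2.le k hki
      rw [xo1 k hki] at this
      rw [xo3 k hki]
      constructor
      · exact fun h => ⟨⟨h.1.1.1, by omega⟩, h.1.2⟩
      · exact fun h => ⟨⟨⟨h.1.1, by omega, by omega⟩, h.2⟩, by omega⟩
  have S4 := moveNum_spec I L i (I.rmax i) (candidates L i (.right i)) n4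
    (hL.candidates_pairwise _ _) (I.exec ops₃)
  have hx4 : I.moveNum i (I.rmax i) (candidates L i (.right i)) (I.exec ops₃) = I.exec ops₄ := by
    rw [hops₄, exec_append]; rfl
  rw [hx4] at S4
  have hops : ops₄ = ops ++ I.scanOps L (I.exec ops) (.left i) := by
    simp only [scanOps]
    rw [hx1, hx2, hx3, hops₄, hops₃, hops₂, hops₁]
    simp
  -- Jobs other than i never gain colors, so a surplus at the end implies one at every earlier
  -- stage; no job has to be reinserted.
  have hS₄' : ∀ k, k ≠ i → (k ∈ S₄ ↔ lpos L k ≤ lpos L i ∧ lpos L i < rpos L k ∧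
      I.rmin k < (I.exec ops₄).x k) := by
    intro k hki
    have l2 := S2.le k hki
    have l4 := S4.le k hki
    rw [xo1 k hki] at l2
    rw [xo3 k hki] at l4
    have hne : lpos L k ≠ lpos L i := fun h => hki (hL.lpos_inj.1 h)
    rw [hS₄, hS₂, hS]
    constructor
    · rintro ⟨⟨⟨a1, a2, a3⟩, a4⟩, a5⟩
      exact ⟨a1.le, a2, a5⟩
    · rintro ⟨a1, a2, a3⟩
      exact ⟨⟨⟨by omega, a2, by omega⟩, by omega⟩, a3⟩
  have hiS₄ : i ∉ S₄ := fun hk => hiS₂ ((hS₄ i).1 hk).1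
  have k9 : μ₄.reg 9 = i := g9'.trans f9'
  have k8 : μ₄.reg 8 = μ.reg 8 := by rw [g8', f8', g8, f8]
  have k7 : μ₄.arr 7 (n + i) = rpos L i := h4.pos (.right i)
  refine .ite (E * S₄.card + 2 * E + B - 6) (by simp [Test.cost, Exp.cost]; omega) ?_ ?_
  · intro hlt
    simp only [Test.Holds, Exp.val, k9, h4.x, h4.rmin] at hlt
    have hcard : E * (insert i S₄).card = E * S₄.card + E := by
      rw [Finset.card_insert_of_notMem hiS₄, Nat.mul_succ]
    refine .seq (.of_loopFree rfl (10 + D + (E * (insert i S₄).card + B))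
      (by simp [Prog.cost, Exp.cost]; omega) ?_)
    refine Rep.runs_insert (I := I) (L := L) (ops := ops₄) (ν := I.exec ops₄) (S := S₄)
      (h4.congr (fun x hx => ?_) ?_) hL hlen i hD hd ?_ (by decide) ?_ fun μ' hs hμ' => ?_
    · simp [Prog.run, show x ≠ 4 by omega]
    · simp [Prog.run]
    · simp [Prog.run, Exp.val, k9, h4.n_eq, k7]; omega
    · simp [Prog.run, Exp.val, k9, h4.n_eq, k7]
    · refine hQ ops₄ (insert i S₄) μ' hops (fun k => ?_) hμ' ?_
      · rw [Finset.mem_insert]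
        by_cases hki : k = i
        · subst hki
          exact ⟨fun _ => ⟨le_rfl, hi, hlt⟩, fun _ => Or.inl rfl⟩
        · rw [or_iff_right hki]; exact hS₄' k hki
      · rw [hs.reg 8 (by omega) (by omega) (by omega)]
        simpa [Prog.run] using k8
  · intro hlt
    simp only [Test.Holds, Exp.val, k9, h4.x, h4.rmin] at hlt
    refine .of_loopFree rfl (E * S₄.card + B) (by simp [Prog.cost]; omega) ?_
    refine hQ ops₄ S₄ _ hops (fun k => ?_) h4 k8
    by_cases hki : k = i
    · subst hki
      exact ⟨fun h => absurd h hiS₄, fun h => absurd h.2.2 hlt⟩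
    · exact hS₄' k hki

/-- The right endpoint in register `9` is scanned. -/
def rightProg : Prog :=
  .seq (.seq releaseProg (.set 4 (.add (.add (.reg 0) (.reg 0)) (.reg 8))))
    (setLeaf 9 queueTest (.lit 0))

theorem Rep.runs_right {I : FBAP n} {L : List (Endpoint n)} {ops : List (ColorOp n)}
    {S : Finset (Fin n)} {μ : Mem} {key : ℕ → ℝ} (h : Rep I L ops (I.exec ops) S μ)
    (hL : I.IsScanOrder L) (hlen : L.length = 2 * n) {d D E : ℕ}
    (hD : D = 100 * (d + 1)) (hE : E = D + 150) (hd : 4 * n ≤ 2 ^ (d + 1)) (i : Fin n)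
    (h9 : μ.reg 9 = n + i) (h8 : μ.reg 8 = rpos L i) {B : ℕ} {Q : ℕ → Mem → Prop}
    (hQ : ∀ ops' μ', ops' = ops ++ I.scanOps L (I.exec ops) (.right i) →
      Rep I L ops' (I.exec ops') (S.erase i) μ' → (I.exec ops').x = (I.exec ops).x →
      μ'.reg 8 = μ.reg 8 → Q (E * (S.erase i).card + B) μ') :
    Runs key rightProg μ (E * S.card + (4 * E + 300) + B) Q := by
  obtain ⟨h1, hreg, -⟩ := h.release (key := key) h9
  have hle : E * (S.erase i).card ≤ E * S.card :=
    Nat.mul_le_mul_left _ Finset.card_erase_le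
  refine .seq (.of_loopFree rfl (10 + D + (E * (S.erase i).card + B)) ?_ ?_)
  · simp [releaseProg, emit, Prog.cost, Exp.cost]; omega
  rw [Prog.run]
  generalize releaseProg.run key μ = μ₁ at *
  have hx : (I.exec ops).apply (.release i) = I.exec (ops ++ [.release i]) := by
    rw [exec_append]; rfl
  rw [hx] at h1
  have g8 : μ₁.reg 8 = μ.reg 8 := hreg 8 (by omega) (by omega)
  refine Rep.runs_delete (h1.congr (fun x hx => ?_) ?_) hL hlen i hD hd ?_ fun μ' hs hμ' => ?_
  · simp [Prog.run, show x ≠ 4 by omega]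
  · simp [Prog.run]
  · simp [Prog.run, Exp.val, g8, h8, h1.n_eq]; omega
  · refine hQ _ μ' rfl hμ' ?_ ?_
    · simp only [scanOps]
      rw [← hx]; rfl
    · rw [hs.reg 8 (by omega) (by omega) (by omega)]
      simpa [Prog.run] using g8

/-- Scan all endpoints. -/
def scanAll : Prog :=
  .seq (.set 8 (.lit 0)) (.loop (.lt (.reg 8) (.add (.reg 0) (.reg 0)))
    (.seq (.set 9 (.get 6 (.reg 8)))
      (.seq (.ite (.lt (.reg 9) (.reg 0)) leftProg rightProg) (.set 8 (.add (.reg 8) (.lit 1))))))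

/-- Between endpoints the queue is exactly the set of active jobs above their minimum. It starts
empty, hence without potential, so a fresh budget `F` per endpoint suffices. -/
theorem Rep.runs_scanAll {I : FBAP n} {L : List (Endpoint n)} {μ : Mem} {key : ℕ → ℝ}
    (h : Rep I L [] I.initNum ∅ μ) (hL : I.IsScanOrder L) (hlen : L.length = 2 * n) {d D E F : ℕ}
    (hD : D = 100 * (d + 1)) (hE : E = D + 150) (hF : F = 4 * E + 400) (hd : 4 * n ≤ 2 ^ (d + 1))
    {B : ℕ} {Q : ℕ → Mem → Prop}
    (hQ : ∀ S' μ', Rep I L (I.allOps L L) (I.exec (I.allOps L L)) S' μ' → Q B μ') :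
    Runs key scanAll μ (10 + 2 * n * F + B) Q := by
  have hcost : (Test.lt (.reg 8) (.add (.reg 0) (.reg 0))).cost = 5 := rfl
  refine .seq (.of_loopFree rfl (8 + 2 * n * F + B) (by simp [Prog.cost, Exp.cost]; omega) ?_)
  refine .mono (Q := fun B' ν => B ≤ B' ∧ Q B ν) ?_ fun B' ν h => ⟨B, h⟩
  refine .loop (fun B' ν => ∃ L' r S, L' <+: L ∧ L'.length + r = 2 * n ∧ ν.reg 8 = L'.length ∧
    Rep I L (I.allOps L L') (I.exec (I.allOps L L')) S ν ∧
    (∀ k, k ∈ S ↔ lpos L k < L'.length ∧ L'.length ≤ rpos L k ∧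
      I.rmin k < (I.exec (I.allOps L L')).x k) ∧
    E * S.card + r * F + 8 + B ≤ B') ?_ ?_ ?_ ?_
  · rintro B' ν ⟨L', r, S, -, -, -, -, -, hB⟩
    rw [hcost]; omega
  · rintro B' ν ⟨L', r, S, hpre, hr, h8, hR, hS, hB⟩ hb
    simp only [Test.Holds, Exp.val, h8, hR.n_eq] at hb
    obtain ⟨r, rfl⟩ : ∃ r', r = r' + 1 := ⟨r - 1, by omega⟩
    rw [Nat.succ_mul] at hB
    obtain ⟨ep, hpre'⟩ : ∃ ep, L' ++ [ep] <+: L := by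
      obtain ⟨t, rfl⟩ := hpre
      cases t with
      | nil => simp at hlen; omega
      | cons ep t => exact ⟨ep, t, by simp⟩
    have hidx := hL.idxOf_of_prefix hpre'
    have h6 : ν.arr 6 L'.length = ep.num := by rw [← hidx]; exact hR.ord ep
    rw [hcost]
    refine .seq (.of_loopFree rfl (E * S.card + (4 * E + 300) + (20 + r * F + 8 + B))
      (by simp [Prog.cost, Exp.cost]; omega) ?_)
    have hR₁ : Rep I L (I.allOps L L') (I.exec (I.allOps L L')) S
        ((Prog.set 9 (.get 6 (.reg 8))).run key ν) :=
      hR.congr (fun x hx => by simp [Prog.run, show x ≠ 9 by omega]) rfl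
    have g9 : ((Prog.set 9 (.get 6 (.reg 8))).run key ν).reg 9 = ep.num := by
      simp [Prog.run, Exp.val, h8, h6]
    have g8 : ((Prog.set 9 (.get 6 (.reg 8))).run key ν).reg 8 = L'.length := by
      simp [Prog.run, h8]
    generalize (Prog.set 9 (.get 6 (.reg 8))).run key ν = ν₁ at *
    have hstep : ∀ S' μ', Rep I L (I.allOps L (L' ++ [ep]))
        (I.exec (I.allOps L (L' ++ [ep]))) S' μ' →
        (∀ k, k ∈ S' ↔ lpos L k < L'.length + 1 ∧ L'.length + 1 ≤ rpos L k ∧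
          I.rmin k < (I.exec (I.allOps L (L' ++ [ep]))).x k) →
        μ'.reg 8 = L'.length →
        Runs key (.set 8 (.add (.reg 8) (.lit 1))) μ' (E * S'.card + (12 + r * F + 8 + B))
          (fun B' ν => ∃ L' r S, L' <+: L ∧ L'.length + r = 2 * n ∧ ν.reg 8 = L'.length ∧
            Rep I L (I.allOps L L') (I.exec (I.allOps L L')) S ν ∧
            (∀ k, k ∈ S ↔ lpos L k < L'.length ∧ L'.length ≤ rpos L k ∧
              I.rmin k < (I.exec (I.allOps L L')).x k) ∧
            E * S.card + r * F + 8 + B ≤ B') := by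
      intro S' μ' hR' hS' h8'
      refine .of_loopFree rfl (E * S'.card + r * F + 8 + B)
        (by simp [Prog.cost, Exp.cost]; omega) ?_
      refine ⟨L' ++ [ep], r, S', hpre', by simp; omega, by simp [Prog.run, Exp.val, h8'],
        hR'.congr (fun x hx => by simp [Prog.run, show x ≠ 8 by omega]) rfl, ?_, le_rfl⟩
      simpa using hS'
    refine .seq (.ite (E * S.card + (4 * E + 300) + (12 + r * F + 8 + B))
      (by simp [Test.cost, Exp.cost]; omega) ?_ ?_)
    · intro hlt
      simp only [Test.Holds, Exp.val, g9, hR₁.n_eq] at hlt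
      cases ep with
      | right i => simp [Endpoint.num] at hlt
      | left i =>
        have hidx : lpos L i = L'.length := hidx
        refine hR₁.runs_left hL hlen hD hE hd i g9 (fun k => ?_) fun ops' S' μ' e hS' hR' g8' => ?_
        · rw [hS k, hidx]
          have := hL.lpos_ne_rpos i k
          constructor
          · exact fun h => ⟨h.1, by omega, h.2.2⟩
          · exact fun h => ⟨h.1, by omega, h.2.2⟩
        · rw [← allOps_append] at e
          subst e
          refine hstep S' μ' hR' (fun k => ?_) (g8'.trans g8)
          rw [hS' k, hidx, Nat.lt_succ_iff, Nat.succ_le_iff]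
    · intro hlt
      simp only [Test.Holds, Exp.val, g9, hR₁.n_eq] at hlt
      cases ep with
      | left i => exact absurd i.2 hlt
      | right i =>
        have hidx : rpos L i = L'.length := hidx
        refine hR₁.runs_right hL hlen hD hE hd i g9 (by rw [g8, hidx])
          fun ops' μ' e hR' hx g8' => ?_
        rw [← allOps_append] at e
        subst e
        refine hstep _ μ' hR' (fun k => ?_) (g8'.trans g8)
        rw [Finset.mem_erase, hS k, hx]
        have h1 := hL.lpos_ne_rpos k i
        by_cases hki : k = i
        · subst hki
          exact ⟨fun h => absurd rfl h.1, fun h => by omega⟩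
        · have h2 : rpos L k ≠ rpos L i := fun h => hki (hL.rpos_inj.1 h)
          constructor
          · exact fun h => ⟨by omega, by omega, h.2.2.2⟩
          · exact fun h => ⟨hki, by omega, by omega, h.2.2⟩
  · rintro B' ν ⟨L', r, S, hpre, hr, h8, hR, hS, hB⟩ hb
    simp only [Test.Holds, Exp.val, h8, hR.n_eq] at hb
    have : L' = L := hpre.eq_of_length (by omega)
    subst this
    exact ⟨by rw [hcost]; omega, hQ S ν hR⟩
  · refine ⟨[], 2 * n, ∅, List.nil_prefix, by simp, by simp [Prog.run, Exp.val],
      h.congr (fun x hx => by simp [Prog.run, show x ≠ 8 by omega]) rfl, by simp,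
      by simp; omega⟩

/-- Paging_FBA as a program. -/
def pagingProg : Prog := .seq insertAll (.seq extractAll scanAll)

theorem runs_pagingProg (I : FBAP n) :
    Runs I.key pagingProg I.input (7000 * (n * Nat.log 2 n + 1)) fun _ μ =>
      ∃ L, I.IsScanOrder L ∧ ∃ S, Rep I L (I.allOps L L) (I.exec (I.allOps L L)) S μ := by
  obtain ⟨D, hD⟩ : ∃ D, D = 100 * (Nat.log 2 n + 2 + 1) := ⟨_, rfl⟩
  obtain ⟨E, hE⟩ : ∃ E, E = D + 150 := ⟨_, rfl⟩
  obtain ⟨F, hF⟩ : ∃ F, F = 4 * E + 400 := ⟨_, rfl⟩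
  -- Both trees have 2n leaves, so node indices stay below 4n, and `n < 2 ^ (Nat.log 2 n + 1)`.
  have hd : 4 * n ≤ 2 ^ (Nat.log 2 n + 2 + 1) := by
    have := Nat.lt_pow_succ_log_self (b := 2) (by omega) n
    rw [Nat.succ_eq_add_one, pow_succ] at this
    rw [pow_succ, pow_succ]
    omega
  -- Absorbs the linear term; for n = 1 the logarithm vanishes and the summand 1 is needed. With it,
  -- 1200 + 5780 stays below 7000.
  have hn : n ≤ n * Nat.log 2 n + 1 := by
    by_cases h : n < 2
    · omega
    · have := Nat.le_mul_of_pos_right n (Nat.log_pos (b := 2) (by omega) (not_lt.1 h))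
      omega
  have hB : 10 + 2 * n * (100 * (Nat.log 2 n + 2 + 1) + 40) +
      (10 + 2 * n * (100 * (Nat.log 2 n + 2 + 1) + 50) + (10 + 2 * n * F + 0)) ≤
      7000 * (n * Nat.log 2 n + 1) := by
    have e : 10 + 2 * n * (100 * (Nat.log 2 n + 2 + 1) + 40) +
      (10 + 2 * n * (100 * (Nat.log 2 n + 2 + 1) + 50) + (10 + 2 * n * F + 0)) =
      1200 * (n * Nat.log 2 n) + 5780 * n + 30 := by
      rw [hF, hE, hD]; ring
    omega
  suffices h : Runs I.key pagingProg I.input _ _ by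
    obtain ⟨t, μ, B', h1, h2, h3⟩ := h
    exact ⟨t, μ, B', h1, h2.trans hB, h3⟩
  refine .seq (runs_insertAll I hd rfl (fun v => ?_) fun μ₁ hreg₁ harr₁ hT hleaf => ?_)
  · simp [input]
  refine .seq (runs_extractAll I hd (hreg₁ 0 (by omega)) hT hleaf fun μ₂ hreg₂ harr₂ hsort => ?_)
  obtain ⟨L, hL, hlen, hord⟩ := hsort.exists_scanOrder
  refine Rep.runs_scanAll (L := L) ?_ hL hlen hD hE hF hd fun S μ₃ hR => ⟨L, hL, S, hR⟩
  have hreg : ∀ x < 4, μ₂.reg x = I.input.reg x := fun x hx => by rw [hreg₂ x hx, hreg₁ x hx]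
  have harr : ∀ a, a ≠ 6 → a ≠ 7 → a ≠ 8 → μ₂.arr a = I.input.arr a := fun a g1 g2 g3 => by
    rw [harr₂ a g1 g2 g3, harr₁ a g3]
  refine ⟨?_, ?_, ?_, ?_, ?_, ?_, ?_, ?_, fun ep => (hord ep).1, fun ep => (hord ep).2, ?_, ?_⟩
  · rw [hreg 0 (by omega)]; rfl
  · rw [hreg 1 (by omega)]; rfl
  · rw [hreg 2 (by omega)]; simp [input, initNum]
  · rw [hreg 3 (by omega)]; simp [input]
  · rw [harr 0 (by omega) (by omega) (by omega)]; simp [input]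
  · rw [harr 1 (by omega) (by omega) (by omega)]; simp [input]
  · rw [harr 2 (by omega) (by omega) (by omega)]; simp [input, initNum]
  · intro j hj; simp at hj
  · rw [harr 9 (by omega) (by omega) (by omega)]
    intro v _ _
    simp [input, winner_self]
  · rw [harr 9 (by omega) (by omega) (by omega)]
    simp [input]

theorem Rep.isOutput {I : FBAP n} {L : List (Endpoint n)} {S : Finset (Fin n)} {μ : Mem}
    (hL : I.IsScanOrder L) (h : Rep I L (I.allOps L L) (I.exec (I.allOps L L)) S μ) :
    I.IsOutput L μ := by
  refine ⟨I.allOps L L, h.len, h.code, fun pick hp => ⟨?_, fun i => ?_, ?_⟩⟩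
  · rw [← (foldl_scan hp hL L List.prefix_rfl).1]; rfl
  · rw [pagingFBA_card hp hL, h.x]
  · simp only [pagingFBA_card hp hL, h.total]

end FBAP

theorem mainTheorem3 :
    -- the algorithm returns an optimal solution
    (∀ (n : ℕ) (I : FBAP n), I.Feasible → (∀ i, I.p i = 1) →
      ∀ L : List (Endpoint n), I.IsScanOrder L →
      ∀ pick : Finset ℕ → ℕ → Finset ℕ, IsPick pick →
        I.IsColoring (I.pagingFBA pick L) ∧
        I.IsOptimal (fun i => (I.pagingFBA pick L i).card)) ∧
    -- and it can be implemented to run in time `O(n log n)`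
    (∃ (P : RAM.Prog) (C : ℕ), ∀ (n : ℕ) (I : FBAP n), I.Feasible → (∀ i, I.p i = 1) →
      ∃ L : List (Endpoint n), I.IsScanOrder L ∧
      ∃ (t : ℕ) (μ : RAM.Mem), RAM.Exec I.key P I.input t μ ∧
        t ≤ C * (n * Nat.log 2 n + 1) ∧ I.IsOutput L μ) := by
  refine ⟨fun n I hI h1 L hL pick hp => ⟨FBAP.pagingFBA_isColoring hp hL,
    FBAP.pagingFBA_isOptimal hp hL hI h1⟩, FBAP.pagingProg, 7000, fun n I _ _ => ?_⟩
  obtain ⟨t, μ, B', h1, h2, L, hL, S, hR⟩ := FBAP.runs_pagingProg I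
  exact ⟨L, hL, t, μ, h1, by omega, hR.isOutput hL⟩
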